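/- **Setting.** For every $n$ let $p=p_n$, let $X=X_n$ be a deterministic $n\times p$ matrix, and let $Y=X\beta+\varepsilon$ with $\varepsilon$ standard normal in $\mathbb R^n$; limits are for $n\to\infty$, with $p=p_n\to\infty$. Write $\|X\|=\max_i\|X_{\cdot,i}\|_2$, $S_\beta=\{i:\beta_i\neq0\}$, and $S_0=S_{\beta^0}$ for the true vector $\beta^0$. The prior $\Pi$ on $\mathbb R^p$ draws a dimension $s$ from a probability distribution $\pi_p$ on $\{0,\dots,p\}$, then a uniformly random set $S\subset\{1,\dots,p\}$ of size $s$, then independent coordinates $\beta_i$, $i\in S$, with Laplace density $x\mapsto\frac{\lambda}{2}e^{-\lambda|x|}$, $\lambda=\lambda_n>0$, and sets $\beta_i=0$ for $i\notin S$. The posterior is $$\Pi(B\mid Y)=\int_Be^{-\|Y-X\beta\|_2^2/2}\,d\Pi(\beta)\Big/\int e^{-\|Y-X\beta\|_2^2/2}\,d\Pi(\beta),$$ and $\mathbb E_{\beta^0}$ is expectation for $Y\sim\mathcal N(X\beta^0,I)$. Let $$\phi(S)=\inf\Bigl\{\tfrac{\|X\beta\|_2|S|^{1/2}}{\|X\|\,\|\beta_S\|_1}:\|\beta_{S^c}\|_1\le7\|\beta_S\|_1,\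 \beta_S\ne0\Bigr\},$$ $$\overline\phi(s)=\inf\Bigl\{\tfrac{\|X\beta\|_2|S_\beta|^{1/2}}{\|X\|\,\|\beta\|_1}:0\ne|S_\beta|\le s\Bigr\},\qquad \widetilde\phi(s)=\inf\Bigl\{\tfrac{\|X\beta\|_2}{\|X\|\,\|\beta\|_2}:0\ne|S_\beta|\le s\Bigr\},$$ with $\inf\emptyset=\infty$, and, with $\overline\lambda=2\|X\|\sqrt{\log p}$, $$\overline\psi(S)=\overline\phi\Bigl(\bigl(2+\tfrac3{A_4}+\tfrac{33}{\phi(S)^2}\tfrac{\lambda}{\overline\lambda}\bigr)|S|\Bigr),\qquad \widetilde\psi(S)=\widetilde\phi\Bigl(\bigl(2+\tfrac3{A_4}+\tfrac{33}{\phi(S)^2}\tfrac{\lambda}{\overline\lambda}\bigr)|S|\Bigr).$$ For $M>0$ let $$\widetilde{\mathrm B}=\Bigl\{\beta:\min_{i\in S_\beta}|\beta_i|\ge\tfrac{M}{\widetilde\psi(S_\beta)^2}\tfrac{\sqrt{|S_\beta|\log p}}{\|X\|\phi(S_\beta)}\Bigr\},\qquad \overline{\mathrm B}=\Bigl\{\beta:\min_{i\in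 S_\beta}|\beta_i|\ge\tfrac{M}{\overline\psi(S_\beta)^2}\tfrac{|S_\beta|\sqrt{\log p}}{\|X\|\phi(S_\beta)}\Bigr\}$$ (both contain $\beta=0$). **Corollary (Consistent model selection).** Let $A_1,A_2,A_3>0$ and $A_4>1$. There is a constant $M_0>0$, depending only on $A_1,\dots,A_4$, such that the following holds for every $M\ge M_0$. Suppose that, for all large $n$, $$A_1p^{-A_3}\pi_p(s-1)\le\pi_p(s)\le A_2p^{-A_4}\pi_p(s-1)\quad(s=1,\dots,p),\qquad \frac{\|X\|}{p}\le\lambda\le2\overline\lambda,$$ and $0\le s_n\le p^a$ for a constant $a<A_4-1$, and that $s_n\lambda\sqrt{\log p}/\|X\|\to0$. Then, for every $c_0>0$, $$\inf_{\substack{\beta^0\in\widetilde{\mathrm B}:\ \phi(S_0)\ge c_0\\ |S_0|\le s_n,\ \widetilde\psi(S_0)\ge c_0}}\mathbb E_{\beta^0}\Pi(\beta:S_\beta=S_{\beta^0}\mid Y)\to1 \quad\text{and}\quad \inf_{\substack{\beta^0\in\overline{\mathrm B}:\ \phi(S_0)\ge c_0\\ |S_0|\le s_n,\ \overline\psi(S_0)\ge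 c_0}}\mathbb E_{\beta^0}\Pi(\beta:S_\beta=S_{\beta^0}\mid Y)\to1 .$$ -/

import Mathlib

open Filter Topology MeasureTheory ProbabilityTheory
open scoped ENNReal

namespace SparseRegression

noncomputable section

/-- The Euclidean norm of a finite real vector. -/
def l2norm {ι : Type*} [Fintype ι] (v : ι → ℝ) : ℝ := ‖WithLp.toLp 2 v‖

/-- The `ℓ¹` norm of the coordinates of `β` in `S`, that is `‖β_S‖₁`. -/
def l1on {p : ℕ} (S : Finset (Fin p)) (β : Fin p → ℝ) : ℝ := ∑ i ∈ S, |β i|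

/-- The support `S_β = {i : β i ≠ 0}`. -/
def supp {p : ℕ} (β : Fin p → ℝ) : Finset (Fin p) := Finset.univ.filter (fun i => β i ≠ 0)

/-- `‖X‖`, the largest Euclidean norm of a column of `X`. -/
def colNorm {n p : ℕ} (X : Matrix (Fin n) (Fin p) ℝ) : ℝ := ⨆ i : Fin p, l2norm (X.col i)

/-- The upper reference value `2 ‖X‖ √(log p)` of the scale parameter. -/
def lamBar {n p : ℕ} (X : Matrix (Fin n) (Fin p) ℝ) : ℝ := 2 * colNorm X * √(Real.log p)

/-! The three compatibility indices are infima in `[0, ∞]`, so the infimum of the empty set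
(which occurs for the empty model) is `∞`. -/

/-- The compatibility number `φ(S)` of the model `S`. -/
def compat {n p : ℕ} (X : Matrix (Fin n) (Fin p) ℝ) (S : Finset (Fin p)) : ℝ≥0∞ :=
  ⨅ (β : Fin p → ℝ) (_ : l1on Sᶜ β ≤ 7 * l1on S β ∧ ∃ i ∈ S, β i ≠ 0),
    ENNReal.ofReal (l2norm (X.mulVec β) * √(S.card : ℝ) / (colNorm X * l1on S β))

/-- The compatibility number in vectors of dimension `s`. -/
def compatBar {n p : ℕ} (X : Matrix (Fin n) (Fin p) ℝ) (s : ℝ≥0∞) : ℝ≥0∞ :=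
  ⨅ (β : Fin p → ℝ) (_ : (supp β).card ≠ 0 ∧ ((supp β).card : ℝ≥0∞) ≤ s),
    ENNReal.ofReal
      (l2norm (X.mulVec β) * √((supp β).card : ℝ) / (colNorm X * l1on Finset.univ β))

/-- The smallest scaled singular value of dimension `s`. -/
def compatTilde {n p : ℕ} (X : Matrix (Fin n) (Fin p) ℝ) (s : ℝ≥0∞) : ℝ≥0∞ :=
  ⨅ (β : Fin p → ℝ) (_ : (supp β).card ≠ 0 ∧ ((supp β).card : ℝ≥0∞) ≤ s),
    ENNReal.ofReal (l2norm (X.mulVec β) / (colNorm X * l2norm β))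

/-- The enlarged dimension `(2 + 3 / A₄ + (33 / φ(S)²) (lam / lamBar)) |S|`. -/
def enlargedDim {n p : ℕ} (X : Matrix (Fin n) (Fin p) ℝ) (A₄ lam : ℝ) (S : Finset (Fin p)) :
    ℝ≥0∞ :=
  (2 + ENNReal.ofReal (3 / A₄) + 33 / compat X S ^ 2 * ENNReal.ofReal (lam / lamBar X))
    * (S.card : ℝ≥0∞)

def psiBar {n p : ℕ} (X : Matrix (Fin n) (Fin p) ℝ) (A₄ lam : ℝ) (S : Finset (Fin p)) : ℝ≥0∞ :=
  compatBar X (enlargedDim X A₄ lam S)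

def psiTilde {n p : ℕ} (X : Matrix (Fin n) (Fin p) ℝ) (A₄ lam : ℝ) (S : Finset (Fin p)) : ℝ≥0∞ :=
  compatTilde X (enlargedDim X A₄ lam S)

/-- `w` is a probability distribution on `{0, …, p}` that satisfies the exponential decay
assumption with constants `A₁, A₂, A₃, A₄`. -/
structure IsDimPrior (A₁ A₂ A₃ A₄ : ℝ) (p : ℕ) (w : ℕ → ℝ) : Prop where
  nonneg : ∀ s ≤ p, 0 ≤ w s
  sum_eq_one : ∑ s ∈ Finset.range (p + 1), w s = 1
  lower : ∀ s, 1 ≤ s → s ≤ p → A₁ * (p : ℝ) ^ (-A₃) * w (s - 1) ≤ w s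
  upper : ∀ s, 1 ≤ s → s ≤ p → w s ≤ A₂ * (p : ℝ) ^ (-A₄) * w (s - 1)

/-- The Laplace distribution, with density `x ↦ (lam / 2) exp (- lam |x|)`. -/
def laplace (lam : ℝ) : Measure ℝ :=
  volume.withDensity (fun x => ENNReal.ofReal (lam / 2 * Real.exp (-lam * |x|)))

/-- The prior on `β`: draw a dimension `s` from `w`, then a uniformly random set `S` of size `s`,
then independent Laplace coordinates in `S`; the coordinates outside `S` are zero. -/
def prior {p : ℕ} (w : ℕ → ℝ) (lam : ℝ) : Measure (Fin p → ℝ) :=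
  ∑ S : Finset (Fin p), ENNReal.ofReal (w S.card / (p.choose S.card : ℝ)) •
    Measure.pi (fun i => if i ∈ S then laplace lam else Measure.dirac (0 : ℝ))

/-- The Gaussian likelihood `exp (- ‖Y - X β‖₂² / 2)`. -/
def likelihood {n p : ℕ} (X : Matrix (Fin n) (Fin p) ℝ) (Y : Fin n → ℝ) (β : Fin p → ℝ) : ℝ≥0∞ :=
  ENNReal.ofReal (Real.exp (-(l2norm (Y - X.mulVec β)) ^ 2 / 2))

/-- The posterior distribution given by Bayes's formula. -/
def posterior {n p : ℕ} (X : Matrix (Fin n) (Fin p) ℝ) (w : ℕ → ℝ) (lam : ℝ) (Y : Fin n → ℝ) :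
    Measure (Fin p → ℝ) :=
  (∫⁻ β, likelihood X Y β ∂(prior w lam))⁻¹ • (prior w lam).withDensity (likelihood X Y)

/-- The law of `Y = X β⁰ + ε`, with `ε` a standard normal vector. -/
def dataLaw {n p : ℕ} (X : Matrix (Fin n) (Fin p) ℝ) (β₀ : Fin p → ℝ) : Measure (Fin n → ℝ) :=
  Measure.pi (fun j => gaussianReal (X.mulVec β₀ j) 1)

/-- The expected posterior mass, under `β⁰`, of the event that `β` has the support of `β⁰`. -/
def trueModelMass {n p : ℕ} (X : Matrix (Fin n) (Fin p) ℝ) (w : ℕ → ℝ) (lam : ℝ)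
    (β₀ : Fin p → ℝ) : ℝ≥0∞ :=
  ∫⁻ Y, posterior X w lam Y {β | supp β = supp β₀} ∂(dataLaw X β₀)

/-- Vectors all of whose nonzero coordinates have size at least
`(M / ψ̃(S_β)²) √(|S_β| log p) / (‖X‖ φ(S_β))`. -/
def BTilde {n p : ℕ} (X : Matrix (Fin n) (Fin p) ℝ) (A₄ lam M : ℝ) : Set (Fin p → ℝ) :=
  {β | ∀ i ∈ supp β,
    ENNReal.ofReal M / psiTilde X A₄ lam (supp β) ^ 2 *
      (ENNReal.ofReal √((supp β).card * Real.log p) /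
        (ENNReal.ofReal (colNorm X) * compat X (supp β))) ≤ ENNReal.ofReal |β i|}

/-- Vectors all of whose nonzero coordinates have size at least
`(M / ψ̄(S_β)²) |S_β| √(log p) / (‖X‖ φ(S_β))`. -/
def BBar {n p : ℕ} (X : Matrix (Fin n) (Fin p) ℝ) (A₄ lam M : ℝ) : Set (Fin p → ℝ) :=
  {β | ∀ i ∈ supp β,
    ENNReal.ofReal M / psiBar X A₄ lam (supp β) ^ 2 *
      (ENNReal.ofReal ((supp β).card * √(Real.log p)) /
        (ENNReal.ofReal (colNorm X) * compat X (supp β))) ≤ ENNReal.ofReal |β i|}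

/-- The true vectors over which the first assertion is uniform. -/
def classTilde {n p : ℕ} (X : Matrix (Fin n) (Fin p) ℝ) (A₄ lam M c₀ s : ℝ) : Set (Fin p → ℝ) :=
  {β | β ∈ BTilde X A₄ lam M ∧ ENNReal.ofReal c₀ ≤ compat X (supp β) ∧
    ((supp β).card : ℝ) ≤ s ∧ ENNReal.ofReal c₀ ≤ psiTilde X A₄ lam (supp β)}

/-- The true vectors over which the second assertion is uniform. -/
def classBar {n p : ℕ} (X : Matrix (Fin n) (Fin p) ℝ) (A₄ lam M c₀ s : ℝ) : Set (Fin p → ℝ) :=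
  {β | β ∈ BBar X A₄ lam M ∧ ENNReal.ofReal c₀ ≤ compat X (supp β) ∧
    ((supp β).card : ℝ) ≤ s ∧ ENNReal.ofReal c₀ ≤ psiBar X A₄ lam (supp β)}

end

end SparseRegression

open SparseRegression

/-! Every wrong model `S` is compared directly with the true model `S₀`, of size `s₀`, through the
ratio of their marginal likelihoods; no posterior contraction rate is needed. The posterior mass of
`S` is at most its prior odds against `S₀` times its Bayes factor, so it suffices that the sum over
`S ≠ S₀` of prior odds times expected Bayes factor vanishes on the event that all correlations of
the noise with the columns are at most `lamBar X`. The complement of this event has probability at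
most `2 / p` (`one_le_trueModelMass_add`, `dataLaw_noiseEvent_compl_le`).

The wrong models fall into three classes. Models with `A₄ (|S| - s₀) > 3 s₀`: the compatibility of
`S₀` bounds the expected evidence by a factor `4` per coordinate (`setLIntegral_relModelLik_le`), a
small box around the truth bounds the evidence of `S₀` from below (`relModelLik_supp_ge`), and the
decay of the dimension prior outweighs the quotient. Smaller proper supersets of `S₀`: the extra
columns are made orthogonal to those of `S₀` by regression. The likelihood then factorizes, the
shift of the Laplace prior costs only an `ℓ¹` exponential, and the expected Bayes factor is at most
`e` because `s₀ λ √(log p) / ‖X‖` is small (`modelLik_union_le`, `setLIntegral_bayesFactor_le`). The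
prior odds are summable because `s₀ ≤ p ^ a` controls the number of ways to choose `S₀` inside `S`.
Smaller models missing a coordinate of the truth: the lower bound on the nonzero coordinates puts
every parameter of `S` so far from the truth that the evidence is at most of order `p ^ (-(4 + A₃)
s₀)`, which beats the box bound and the prior odds (`relModelLik_le_of_separated`).

The expectations rest on `setLIntegral_likRatio_le`, which uses part of the noise pathwise and the
rest through its Gaussian moment generating function. The powers of the compatibility index in the
lower bound on the coordinates cancel exactly, so the constant `M₀` does not depend on `c₀`. The
resulting error depends on `A₂` and `p` only, which gives uniformity. -/

namespace SparseRegression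

/-! ### The Laplace distribution. -/

theorem integral_laplace_density {lam : ℝ} (h : 0 < lam) :
    ∫ x : ℝ, lam / 2 * Real.exp (-lam * |x|) = 1 := by
  rw [integral_const_mul, integral_comp_abs (f := fun x => Real.exp (-lam * x)),
    integral_exp_mul_Ioi (by linarith)]
  simp
  field_simp

theorem lintegral_laplace_density {lam : ℝ} (h : 0 < lam) :
    ∫⁻ x : ℝ, ENNReal.ofReal (lam / 2 * Real.exp (-lam * |x|)) = 1 := by
  rw [← ofReal_integral_eq_lintegral_ofReal, integral_laplace_density h, ENNReal.ofReal_one]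
  · by_contra hc
    have := integral_laplace_density h
    rw [integral_undef hc] at this
    norm_num at this
  · exact ae_of_all _ fun x => by positivity

instance laplace_isProbabilityMeasure {lam : ℝ} [h : Fact (0 < lam)] :
    IsProbabilityMeasure (laplace lam) :=
  ⟨by rw [laplace, withDensity_apply _ MeasurableSet.univ, Measure.restrict_univ,
    lintegral_laplace_density h.out]⟩

theorem lintegral_laplace (lam : ℝ) (f : ℝ → ℝ≥0∞) (hf : Measurable f) :
    ∫⁻ x, f x ∂(laplace lam) =
      ∫⁻ x, ENNReal.ofReal (lam / 2 * Real.exp (-lam * |x|)) * f x := by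
  rw [laplace, lintegral_withDensity_eq_lintegral_mul _ (by fun_prop) hf]
  rfl

/-- Change of the scale and of the centre of the Laplace distribution. -/
theorem lintegral_laplace_tilt {lam k : ℝ} (h : 0 < lam) (hk : 0 < k) (a : ℝ) :
    ∫⁻ x, ENNReal.ofReal (Real.exp (lam * |x| - k * lam * |x - a|)) ∂(laplace lam) =
      ENNReal.ofReal k⁻¹ := by
  rw [lintegral_laplace _ _ (by fun_prop)]
  have h1 : ∀ x : ℝ, ENNReal.ofReal (lam / 2 * Real.exp (-lam * |x|)) *
      ENNReal.ofReal (Real.exp (lam * |x| - k * lam * |x - a|)) =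
      ENNReal.ofReal k⁻¹ *
        ENNReal.ofReal ((k * lam) / 2 * Real.exp (-(k * lam) * |x - a|)) := by
    intro x
    rw [← ENNReal.ofReal_mul (by positivity), ← ENNReal.ofReal_mul (by positivity), mul_assoc,
      ← Real.exp_add]
    congr 1
    rw [show -lam * |x| + (lam * |x| - k * lam * |x - a|) = -(k * lam) * |x - a| by ring]
    field_simp
  simp_rw [h1]
  rw [lintegral_const_mul _ (by fun_prop), lintegral_sub_right_eq_self
    (fun x => ENNReal.ofReal ((k * lam) / 2 * Real.exp (-(k * lam) * |x|))) a,
    lintegral_laplace_density (by positivity), mul_one]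

/-- The triangle inequality `|x| ≤ |x - g| + |g|` in the exponent of the density. This is what makes
recentring the prior cheap. -/
theorem map_add_laplace_le {lam : ℝ} (h : 0 < lam) (g : ℝ) :
    (laplace lam).map (fun x => x + g) ≤
      ENNReal.ofReal (Real.exp (lam * |g|)) • laplace lam := by
  refine Measure.le_iff.2 fun s hs => ?_
  rw [Measure.map_apply (by fun_prop) hs, Measure.smul_apply, smul_eq_mul, laplace,
    withDensity_apply _ hs, withDensity_apply _ (by measurability),
    ← lintegral_indicator hs, ← lintegral_indicator (by measurability),
    ← lintegral_const_mul _ ((by fun_prop : Measurable _).indicator hs),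
    ← lintegral_sub_right_eq_self _ g]
  refine lintegral_mono fun x => ?_
  by_cases hx : x ∈ s
  · rw [Set.indicator_of_mem (by simpa using hx), Set.indicator_of_mem hx,
      ← ENNReal.ofReal_mul (by positivity)]
    refine ENNReal.ofReal_le_ofReal ?_
    rw [mul_left_comm, ← Real.exp_add]
    gcongr
    have : |x| ≤ |x - g| + |g| := by simpa using abs_add_le (x - g) g
    nlinarith
  · rw [Set.indicator_of_notMem (by simpa using hx)]
    exact zero_le

theorem laplace_Icc_ge {lam r : ℝ} (h : 0 < lam) (_ : 0 ≤ r) :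
    ENNReal.ofReal (lam * r * Real.exp (-lam * r)) ≤ laplace lam (Set.Icc (-r) r) := by
  rw [laplace, withDensity_apply _ measurableSet_Icc]
  calc ENNReal.ofReal (lam * r * Real.exp (-lam * r))
      = ∫⁻ x in Set.Icc (-r) r, ENNReal.ofReal (lam / 2 * Real.exp (-lam * r)) := by
        rw [setLIntegral_const, Real.volume_Icc, ← ENNReal.ofReal_mul (by positivity)]
        congr 1; ring
    _ ≤ _ := by
        refine setLIntegral_mono (by fun_prop) fun x hx => ENNReal.ofReal_le_ofReal ?_
        have : |x| ≤ r := abs_le.2 hx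
        refine mul_le_mul_of_nonneg_left (Real.exp_le_exp.2 ?_) (by positivity)
        exact mul_le_mul_of_nonpos_left this (by linarith)

/-! Product measures -/

theorem pi_le_prod_smul_pi {ι : Type*} [Fintype ι] {μ ν : ι → Measure ℝ} [∀ i, SigmaFinite (μ i)]
    [∀ i, SigmaFinite (ν i)] {c : ι → ℝ≥0∞} (hc : ∀ i, c i ≠ ∞) (h : ∀ i, μ i ≤ c i • ν i) :
    Measure.pi μ ≤ (∏ i, c i) • Measure.pi ν := by
  have : ∀ i, SigmaFinite (c i • ν i) := fun i => by
    lift c to ι → NNReal using hc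
    exact inferInstanceAs (SigmaFinite (c i • ν i))
  have key : Measure.pi μ ≤ Measure.pi (fun i => c i • ν i) := by
    refine Measure.le_iff.2 fun s hs => ?_
    rw [Measure.pi, Measure.pi, toMeasure_apply _ _ hs, toMeasure_apply _ _ hs]
    -- The product outer measure is the largest one bounded by the product formula on boxes, so
    -- domination need only be checked there.
    refine (OuterMeasure.le_pi.2 fun t _ => ?_ : OuterMeasure.pi _ ≤ _) s
    exact (OuterMeasure.pi_pi_le _ t).trans (Finset.prod_le_prod' fun i _ => h i (t i))
  refine key.trans (le_of_eq (Measure.pi_eq fun s _ => ?_))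
  simp [Measure.pi_pi, Finset.prod_mul_distrib]

theorem lintegral_pi_prod {ι : Type*} [Fintype ι] (μ : ι → Measure ℝ)
    [∀ i, IsProbabilityMeasure (μ i)] (f : ι → ℝ → ℝ≥0∞) (hf : ∀ i, Measurable (f i)) :
    ∫⁻ x, ∏ i, f i (x i) ∂(Measure.pi μ) = ∏ i, ∫⁻ x, f i x ∂(μ i) := by
  rw [lintegral_prod_eq_prod_lintegral_of_indepFun (μ := Measure.pi μ) Finset.univ
    (fun i x => f i (x i))]
  · refine Finset.prod_congr rfl fun i _ => ?_
    exact (measurePreserving_eval μ i).lintegral_comp (hf i)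
  · exact iIndepFun_pi (X := fun i => f i) fun i => (hf i).aemeasurable
  · intro i; fun_prop

theorem map_add_pi_prod_pi {ι : Type*} [Fintype ι] (μ ν : ι → Measure ℝ)
    [∀ i, IsProbabilityMeasure (μ i)] [∀ i, IsProbabilityMeasure (ν i)] :
    ((Measure.pi μ).prod (Measure.pi ν)).map (fun z => z.1 + z.2) =
      Measure.pi (fun i => ((μ i).prod (ν i)).map (fun z => z.1 + z.2)) := by
  have : ∀ i, IsProbabilityMeasure (((μ i).prod (ν i)).map (fun z => z.1 + z.2)) := fun i =>
    Measure.isProbabilityMeasure_map (by fun_prop)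
  rw [← Measure.pi_map_pi (μ := fun i => (μ i).prod (ν i)) (f := fun _ z => z.1 + z.2)
    (fun i => by fun_prop), ← (measurePreserving_arrowProdEquivProdArrow ℝ ℝ ι μ ν).map_eq,
    Measure.map_map (by fun_prop) (by fun_prop)]
  rfl

end SparseRegression

/-! ### The prior given a model: supports, translations, tilts, splitting. -/

namespace SparseRegression

variable {p : ℕ} {lam : ℝ} [hlam : Fact (0 < lam)]

/-- The law of a coordinate of `β` under the prior, given the model `S`. -/
noncomputable def coordLaw (lam : ℝ) (S : Finset (Fin p)) (i : Fin p) : Measure ℝ :=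
  if i ∈ S then laplace lam else Measure.dirac 0

/-- The prior on `β` given the model `S`. -/
noncomputable def slab (lam : ℝ) (S : Finset (Fin p)) : Measure (Fin p → ℝ) :=
  Measure.pi (coordLaw lam S)

instance coordLaw_isProbabilityMeasure (S : Finset (Fin p)) (i : Fin p) :
    IsProbabilityMeasure (coordLaw lam S i) := by
  unfold coordLaw; split_ifs <;> infer_instance

instance slab_isProbabilityMeasure (S : Finset (Fin p)) : IsProbabilityMeasure (slab lam S) := by
  unfold slab; infer_instance

omit hlam in
theorem prior_eq_sum_slab (w : ℕ → ℝ) : prior (p := p) w lam =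
    ∑ S : Finset (Fin p), ENNReal.ofReal (w S.card / (p.choose S.card : ℝ)) • slab lam S := rfl

theorem slab_ae_eq_zero (S : Finset (Fin p)) :
    ∀ᵐ β ∂(slab lam S), ∀ i ∉ S, β i = 0 := by
  rw [ae_all_iff]
  intro i
  by_cases hi : i ∈ S
  · simp [hi]
  · have : ∀ᵐ x ∂(coordLaw lam S i), x = 0 := by
      simp [coordLaw, hi, ae_dirac_eq]
    filter_upwards [(Measure.quasiMeasurePreserving_eval _ i).ae this] with β hβ _ using hβ

instance laplace_nullSingletonClass : NullSingletonClass (laplace lam) := by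
  unfold laplace; infer_instance

theorem slab_ae_supp_eq (S : Finset (Fin p)) : ∀ᵐ β ∂(slab lam S), supp β = S := by
  have h1 : ∀ᵐ β ∂(slab lam S), ∀ i ∈ S, β i ≠ 0 := by
    rw [ae_all_iff]
    intro i
    by_cases hi : i ∈ S
    · have : ∀ᵐ x ∂(coordLaw lam S i), x ≠ 0 := by
        have := Measure.ae_ne (laplace lam) 0
        simpa [coordLaw, hi] using this
      filter_upwards [(Measure.quasiMeasurePreserving_eval _ i).ae this] with β hβ _ using hβ
    · simp [hi]
  filter_upwards [h1, slab_ae_eq_zero S] with β h1 h2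
  ext i
  simp only [supp, Finset.mem_filter, Finset.mem_univ, true_and]
  exact ⟨fun h => by_contra fun h' => h (h2 i h'), h1 i⟩

theorem map_add_slab_le (S : Finset (Fin p)) (g : Fin p → ℝ) (hg : ∀ i ∉ S, g i = 0) :
    (slab lam S).map (fun β => β + g) ≤
      ENNReal.ofReal (Real.exp (lam * l1on Finset.univ g)) • slab lam S := by
  have : ∀ i, IsProbabilityMeasure ((coordLaw lam S i).map (fun x => x + g i)) := fun i =>
    Measure.isProbabilityMeasure_map (by fun_prop)
  have h1 : (slab lam S).map (fun β => β + g) =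
      Measure.pi (fun i => (coordLaw lam S i).map (fun x => x + g i)) :=
    Measure.pi_map_pi (μ := coordLaw lam S) (f := fun i x => x + g i) fun i => by fun_prop
  have h2 : ENNReal.ofReal (Real.exp (lam * l1on Finset.univ g)) =
      ∏ i, ENNReal.ofReal (Real.exp (lam * |g i|)) := by
    rw [← ENNReal.ofReal_prod_of_nonneg (fun _ _ => by positivity), ← Real.exp_sum, l1on,
      Finset.mul_sum]
  rw [h1, h2]
  refine pi_le_prod_smul_pi (by simp) fun i => ?_
  by_cases hi : i ∈ S
  · simpa [coordLaw, hi] using map_add_laplace_le hlam.out (g i)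
  · simp [coordLaw, hi, hg i hi]

theorem lintegral_slab_translate_le (S : Finset (Fin p)) (g : Fin p → ℝ) (hg : ∀ i ∉ S, g i = 0)
    {f : (Fin p → ℝ) → ℝ≥0∞} (hf : Measurable f) :
    ∫⁻ β, f (β + g) ∂(slab lam S) ≤
      ENNReal.ofReal (Real.exp (lam * l1on Finset.univ g)) * ∫⁻ β, f β ∂(slab lam S) := by
  rw [← lintegral_map (f := f) (g := fun β => β + g) hf (by fun_prop), ← smul_eq_mul,
    ← lintegral_smul_measure]
  exact lintegral_mono' (map_add_slab_le S g hg) le_rfl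

/-- The factor `exp (λ ‖β_S‖₁)` cancels the Laplace density and leaves, in each coordinate of `S`,
an unnormalized Laplace density of scale `k λ` centred at `a`. It is used with `k = 1 / 4` and `k =
1`. -/
theorem lintegral_slab_tilt {k : ℝ} (hk : 0 < k) (S : Finset (Fin p)) (a : Fin p → ℝ) :
    ∫⁻ β, ENNReal.ofReal (Real.exp (lam * l1on S β - k * lam * l1on S (β - a))) ∂(slab lam S) =
      ENNReal.ofReal (k⁻¹ ^ S.card) := by
  have h1 : ∀ β : Fin p → ℝ,
      ENNReal.ofReal (Real.exp (lam * l1on S β - k * lam * l1on S (β - a))) =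
      ∏ i, if i ∈ S then ENNReal.ofReal (Real.exp (lam * |β i| - k * lam * |β i - a i|)) else 1 := by
    intro β
    rw [Finset.prod_ite_mem, Finset.univ_inter,
      ← ENNReal.ofReal_prod_of_nonneg (fun _ _ => by positivity), ← Real.exp_sum,
      Finset.sum_sub_distrib, ← Finset.mul_sum, ← Finset.mul_sum]
    rfl
  simp_rw [h1]
  have h2 : ∫⁻ β, ∏ i, (if i ∈ S then
      ENNReal.ofReal (Real.exp (lam * |β i| - k * lam * |β i - a i|)) else 1) ∂(slab lam S) =
      ∏ i, ∫⁻ x, (if i ∈ S then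
        ENNReal.ofReal (Real.exp (lam * |x| - k * lam * |x - a i|)) else 1) ∂(coordLaw lam S i) :=
    lintegral_pi_prod (coordLaw lam S) (fun i x => if i ∈ S then
      ENNReal.ofReal (Real.exp (lam * |x| - k * lam * |x - a i|)) else 1) fun i => by
        split_ifs <;> fun_prop
  have h3 : ∀ i, ∫⁻ x, (if i ∈ S then
        ENNReal.ofReal (Real.exp (lam * |x| - k * lam * |x - a i|)) else 1) ∂(coordLaw lam S i) =
      if i ∈ S then ENNReal.ofReal k⁻¹ else 1 := by
    intro i
    by_cases hi : i ∈ S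
    · simpa [coordLaw, hi] using lintegral_laplace_tilt hlam.out hk (a i)
    · simp [hi]
  rw [h2, Finset.prod_congr rfl fun i _ => h3 i, Finset.prod_ite_mem, Finset.univ_inter,
    Finset.prod_const, ENNReal.ofReal_pow (by positivity)]

theorem slab_box_ge {r : ℝ} (hr : 0 ≤ r) (S : Finset (Fin p)) :
    ENNReal.ofReal ((lam * r * Real.exp (-lam * r)) ^ S.card) ≤
      slab lam S (Set.univ.pi fun _ => Set.Icc (-r) r) := by
  have hl := hlam.out
  rw [slab, Measure.pi_pi, ENNReal.ofReal_pow (by positivity)]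
  have : ∀ i, (if i ∈ S then ENNReal.ofReal (lam * r * Real.exp (-lam * r)) else 1) ≤
      coordLaw lam S i (Set.Icc (-r) r) := by
    intro i
    by_cases hi : i ∈ S
    · simpa [coordLaw, hi] using laplace_Icc_ge hlam.out hr
    · simp [coordLaw, hi, hr]
  calc _ = ∏ i, (if i ∈ S then ENNReal.ofReal (lam * r * Real.exp (-lam * r)) else 1) := by
        rw [Finset.prod_ite_mem, Finset.univ_inter, Finset.prod_const]
    _ ≤ _ := Finset.prod_le_prod' fun i _ => this i

/-- A vector drawn from the larger model is the sum of independent draws from the two parts: in each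
coordinate at least one summand is a point mass at zero, so the convolution is trivial. -/
theorem lintegral_slab_union {S T : Finset (Fin p)} (h : Disjoint S T)
    {f : (Fin p → ℝ) → ℝ≥0∞} (hf : Measurable f) :
    ∫⁻ β, f β ∂(slab lam (S ∪ T)) =
      ∫⁻ c, ∫⁻ b, f (b + c) ∂(slab lam S) ∂(slab lam T) := by
  have h1 : slab lam (S ∪ T) =
      ((slab lam S).prod (slab lam T)).map (fun z => z.1 + z.2) := by
    rw [slab, slab, slab, map_add_pi_prod_pi]
    congr 1
    ext1 i
    by_cases hi : i ∈ S
    · have hT : i ∉ T := Finset.disjoint_left.1 h hi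
      simp only [coordLaw, hi, hT, Finset.mem_union, true_or, if_true, if_false]
      exact (Measure.conv_dirac_zero _).symm
    · by_cases hT : i ∈ T
      · simp only [coordLaw, hi, hT, Finset.mem_union, or_true, if_true, if_false]
        exact (Measure.dirac_zero_conv _).symm
      · simp only [coordLaw, hi, hT, Finset.mem_union, or_self, if_false]
        exact (Measure.dirac_zero_conv _).symm
  rw [h1, lintegral_map hf (by fun_prop),
    lintegral_prod_symm _ (by fun_prop)]

end SparseRegression

/-! ### Norms, the likelihood ratio and the noise event. -/

namespace SparseRegression

theorem l2norm_nonneg {ι : Type*} [Fintype ι] (v : ι → ℝ) : 0 ≤ l2norm v := norm_nonneg _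

theorem l2norm_sq {ι : Type*} [Fintype ι] (v : ι → ℝ) : l2norm v ^ 2 = v ⬝ᵥ v := by
  rw [l2norm, EuclideanSpace.norm_sq_eq]
  simp [dotProduct, sq]

theorem abs_le_l2norm {ι : Type*} [Fintype ι] (v : ι → ℝ) (i : ι) : |v i| ≤ l2norm v := by
  exact PiLp.norm_apply_le (WithLp.toLp 2 v) i

theorem l1on_nonneg {p : ℕ} (S : Finset (Fin p)) (β : Fin p → ℝ) : 0 ≤ l1on S β :=
  Finset.sum_nonneg fun _ _ => abs_nonneg _

theorem l1on_add_l1on_compl {p : ℕ} (S : Finset (Fin p)) (β : Fin p → ℝ) :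
    l1on S β + l1on Sᶜ β = l1on Finset.univ β := Finset.sum_add_sum_compl S _

theorem l1on_le_univ {p : ℕ} (S : Finset (Fin p)) (β : Fin p → ℝ) :
    l1on S β ≤ l1on Finset.univ β := by
  linarith [l1on_add_l1on_compl S β, l1on_nonneg Sᶜ β]

theorem l1on_le_l1on_add_sub {p : ℕ} (S : Finset (Fin p)) (β γ : Fin p → ℝ) :
    l1on S β ≤ l1on S γ + l1on S (γ - β) := by
  unfold l1on
  rw [← Finset.sum_add_distrib]
  refine Finset.sum_le_sum fun i _ => ?_
  have := abs_add_le (γ i) (β i - γ i)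
  rw [abs_sub_comm] at this
  simpa using this

theorem l1on_eq_univ {p : ℕ} {S : Finset (Fin p)} {β : Fin p → ℝ} (h : ∀ i ∉ S, β i = 0) :
    l1on S β = l1on Finset.univ β :=
  Finset.sum_subset (Finset.subset_univ S) fun i _ hi => by simp [h i hi]

theorem l1on_eq_zero {p : ℕ} {S : Finset (Fin p)} {β : Fin p → ℝ} (h : ∀ i ∈ S, β i = 0) :
    l1on S β = 0 :=
  Finset.sum_eq_zero fun i hi => by simp [h i hi]

theorem abs_le_l1on {p : ℕ} {S : Finset (Fin p)} (β : Fin p → ℝ) {i : Fin p} (hi : i ∈ S) :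
    |β i| ≤ l1on S β :=
  Finset.single_le_sum (f := fun i => |β i|) (fun _ _ => abs_nonneg _) hi

@[fun_prop]
theorem continuous_l1on {p : ℕ} (S : Finset (Fin p)) : Continuous (l1on S) := by
  unfold l1on; fun_prop

@[fun_prop]
theorem continuous_l2norm {ι : Type*} [Fintype ι] : Continuous (l2norm : (ι → ℝ) → ℝ) := by
  unfold l2norm; fun_prop

variable {n p : ℕ} (X : Matrix (Fin n) (Fin p) ℝ)

theorem l2norm_col_le (i : Fin p) : l2norm (X.col i) ≤ colNorm X :=
  le_ciSup (f := fun i => l2norm (X.col i)) (Set.finite_range _).bddAbove i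

theorem colNorm_nonneg : 0 ≤ colNorm X := Real.iSup_nonneg fun _ => l2norm_nonneg _

theorem l2norm_mulVec_le (h : Fin p → ℝ) :
    l2norm (X.mulVec h) ≤ colNorm X * l1on Finset.univ h := by
  have h1 : X.mulVec h = ∑ i, h i • X.col i := by
    rw [Matrix.mulVec_eq_sum]
    simp [Matrix.col]
  rw [h1, l2norm, WithLp.toLp_sum, l1on, Finset.mul_sum]
  refine (norm_sum_le _ _).trans (Finset.sum_le_sum fun i _ => ?_)
  rw [WithLp.toLp_smul, norm_smul, Real.norm_eq_abs, mul_comm]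
  exact mul_le_mul_of_nonneg_right (l2norm_col_le X i) (abs_nonneg _)

/-- The likelihood ratio of `β⁰ + h` and `β⁰` at the noise vector `e`. -/
noncomputable def likRatio (e : Fin n → ℝ) (h : Fin p → ℝ) : ℝ :=
  Real.exp (e ⬝ᵥ X.mulVec h - l2norm (X.mulVec h) ^ 2 / 2)

theorem continuous_likRatio :
    Continuous (fun z : (Fin n → ℝ) × (Fin p → ℝ) => likRatio X z.1 z.2) := by
  unfold likRatio
  have h1 : Continuous fun z : (Fin n → ℝ) × (Fin p → ℝ) => X.mulVec z.2 := by fun_prop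
  have h2 : Continuous fun z : (Fin n → ℝ) × (Fin p → ℝ) => l2norm (X.mulVec z.2) :=
    continuous_l2norm.comp h1
  fun_prop

theorem continuous_likelihood :
    Continuous (fun z : (Fin n → ℝ) × (Fin p → ℝ) => likelihood X z.1 z.2) := by
  unfold likelihood
  have h2 : Continuous fun z : (Fin n → ℝ) × (Fin p → ℝ) => l2norm (z.1 - X.mulVec z.2) :=
    continuous_l2norm.comp (by fun_prop)
  exact ENNReal.continuous_ofReal.comp (by fun_prop)

/-- The centre is arbitrary so that the identity serves both around the truth and around the shifted
parameter in the comparison with supersets. -/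
theorem likelihood_add (Y : Fin n → ℝ) (β h : Fin p → ℝ) :
    likelihood X Y (β + h) =
      likelihood X Y β * ENNReal.ofReal (likRatio X (Y - X.mulVec β) h) := by
  unfold likelihood likRatio
  rw [← ENNReal.ofReal_mul (by positivity), ← Real.exp_add]
  congr 2
  rw [l2norm_sq, l2norm_sq, l2norm_sq, Matrix.mulVec_add, ← sub_sub]
  simp only [sub_dotProduct, dotProduct_sub]
  rw [dotProduct_comm (X.mulVec h) Y, dotProduct_comm (X.mulVec h) (X.mulVec β)]
  ring

/-- The event that the noise is uncorrelated with the columns of `X` up to `lamBar X`. -/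
def noiseEvent (β₀ : Fin p → ℝ) : Set (Fin n → ℝ) :=
  {Y | ∀ i, |(Y - X.mulVec β₀) ⬝ᵥ X.col i| ≤ lamBar X}

theorem measurableSet_noiseEvent (β₀ : Fin p → ℝ) : MeasurableSet (noiseEvent X β₀) := by
  unfold noiseEvent
  simp only [Set.ofPred_forall]
  refine MeasurableSet.iInter fun i => measurableSet_le ?_ measurable_const
  have : Continuous fun Y : Fin n → ℝ => (Y - X.mulVec β₀) ⬝ᵥ X.col i := by fun_prop
  exact (this.abs).measurable

theorem abs_dotProduct_mulVec_le {β₀ : Fin p → ℝ} {Y : Fin n → ℝ} (hY : Y ∈ noiseEvent X β₀)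
    (h : Fin p → ℝ) :
    |(Y - X.mulVec β₀) ⬝ᵥ X.mulVec h| ≤ lamBar X * l1on Finset.univ h := by
  have h1 : (Y - X.mulVec β₀) ⬝ᵥ X.mulVec h = ∑ i, h i * ((Y - X.mulVec β₀) ⬝ᵥ X.col i) := by
    rw [Matrix.dotProduct_mulVec, dotProduct_comm]
    rfl
  rw [h1, l1on, Finset.mul_sum]
  refine (Finset.abs_sum_le_sum_abs _ _).trans (Finset.sum_le_sum fun i _ => ?_)
  rw [abs_mul, mul_comm]
  exact mul_le_mul_of_nonneg_right (hY i) (abs_nonneg _)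

instance (β₀ : Fin p → ℝ) : IsProbabilityMeasure (dataLaw X β₀) := by
  unfold dataLaw; infer_instance

theorem lintegral_exp_gaussianReal (m u : ℝ) :
    ∫⁻ y, ENNReal.ofReal (Real.exp ((y - m) * u)) ∂(gaussianReal m 1) =
      ENNReal.ofReal (Real.exp (u ^ 2 / 2)) := by
  have h1 : mgf id (gaussianReal m 1) u = Real.exp (m * u + u ^ 2 / 2) := by
    simpa using mgf_gaussianReal (p := gaussianReal m 1) (X := id) (μ := m) (v := 1) (by simp) u
  have h2 : ∀ y : ℝ, Real.exp ((y - m) * u) = Real.exp (-(m * u)) * Real.exp (u * y) := fun y => by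
    rw [← Real.exp_add]; congr 1; ring
  have hi : Integrable (fun y => Real.exp (u * y)) (gaussianReal m 1) :=
    integrable_exp_mul_gaussianReal u
  rw [← ofReal_integral_eq_lintegral_ofReal]
  · simp_rw [h2]
    rw [integral_const_mul]
    change ENNReal.ofReal (_ * mgf id (gaussianReal m 1) u) = _
    rw [h1, ← Real.exp_add]
    congr 2; ring
  · simp_rw [h2]
    exact hi.const_mul _
  · exact ae_of_all _ fun y => by positivity

theorem lintegral_exp_dataLaw (β₀ : Fin p → ℝ) (u : Fin n → ℝ) :
    ∫⁻ Y, ENNReal.ofReal (Real.exp ((Y - X.mulVec β₀) ⬝ᵥ u)) ∂(dataLaw X β₀) =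
      ENNReal.ofReal (Real.exp (l2norm u ^ 2 / 2)) := by
  have h1 : ∀ Y : Fin n → ℝ, ENNReal.ofReal (Real.exp ((Y - X.mulVec β₀) ⬝ᵥ u)) =
      ∏ j, ENNReal.ofReal (Real.exp ((Y j - X.mulVec β₀ j) * u j)) := fun Y => by
    rw [← ENNReal.ofReal_prod_of_nonneg (fun _ _ => by positivity), ← Real.exp_sum]
    rfl
  simp_rw [h1]
  rw [dataLaw, lintegral_pi_prod _ (fun j y => ENNReal.ofReal (Real.exp ((y - X.mulVec β₀ j) * u j)))
    (fun j => by fun_prop)]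
  simp_rw [lintegral_exp_gaussianReal]
  rw [← ENNReal.ofReal_prod_of_nonneg (fun _ _ => by positivity), ← Real.exp_sum, l2norm_sq,
    dotProduct, Finset.sum_div]
  simp_rw [sq]

/-- Chernoff bound for a linear functional of the noise. -/
theorem dataLaw_dotProduct_ge_le (β₀ : Fin p → ℝ) (u : Fin n → ℝ) (c : ℝ) :
    dataLaw X β₀ {Y | c ≤ (Y - X.mulVec β₀) ⬝ᵥ u} ≤
      ENNReal.ofReal (Real.exp (l2norm u ^ 2 / 2 - c)) := by
  have hm : Continuous fun Y : Fin n → ℝ => (Y - X.mulVec β₀) ⬝ᵥ u := by fun_prop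
  calc dataLaw X β₀ {Y | c ≤ (Y - X.mulVec β₀) ⬝ᵥ u}
      ≤ dataLaw X β₀ {Y | 1 ≤ ENNReal.ofReal (Real.exp (-c)) *
          ENNReal.ofReal (Real.exp ((Y - X.mulVec β₀) ⬝ᵥ u))} := by
        refine measure_mono fun Y hY => ?_
        simp only [Set.mem_ofPred_eq] at hY ⊢
        rw [← ENNReal.ofReal_mul (by positivity), ← Real.exp_add, ENNReal.one_le_ofReal,
          Real.one_le_exp_iff]
        linarith
    _ ≤ (∫⁻ Y, ENNReal.ofReal (Real.exp (-c)) *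
          ENNReal.ofReal (Real.exp ((Y - X.mulVec β₀) ⬝ᵥ u)) ∂(dataLaw X β₀)) / 1 := by
        have := hm.measurable
        exact meas_ge_le_lintegral_div (by fun_prop) one_ne_zero ENNReal.one_ne_top
    _ = _ := by
        have := hm.measurable
        rw [div_one, lintegral_const_mul _ (by fun_prop), lintegral_exp_dataLaw,
          ← ENNReal.ofReal_mul (by positivity), ← Real.exp_add]
        congr 2; ring

theorem l2norm_smul {ι : Type*} [Fintype ι] (t : ℝ) (v : ι → ℝ) :
    l2norm (t • v) = |t| * l2norm v := by
  rw [l2norm, WithLp.toLp_smul, norm_smul, Real.norm_eq_abs]; rfl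

/-- Union bound over the `2p` one-sided deviations. The tilt `2 L / N` gives the Chernoff exponent
`2 L² - 4 L²`, hence probability at most `p⁻²` for each. -/
theorem dataLaw_noiseEvent_compl_le (hN : 0 < colNorm X) (hp : 1 ≤ p) (β₀ : Fin p → ℝ) :
    dataLaw X β₀ (noiseEvent X β₀)ᶜ ≤ ENNReal.ofReal (2 / p) := by
  have hp0 : (0 : ℝ) < p := by exact_mod_cast hp
  have hlog : 0 ≤ Real.log p := Real.log_nonneg (by exact_mod_cast hp)
  set L := √(Real.log p) with hL
  have hL2 : L ^ 2 = Real.log p := Real.sq_sqrt hlog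
  have hL0 : 0 ≤ L := Real.sqrt_nonneg _
  set N := colNorm X
  have key : ∀ (i : Fin p) (σ : ℝ), |σ| = 1 →
      dataLaw X β₀ {Y | 4 * L ^ 2 ≤ (Y - X.mulVec β₀) ⬝ᵥ ((σ * (2 * L / N)) • X.col i)} ≤
        ENNReal.ofReal (1 / (p : ℝ) ^ 2) := by
    intro i σ hσ
    refine (dataLaw_dotProduct_ge_le X β₀ _ _).trans (ENNReal.ofReal_le_ofReal ?_)
    have h1 : l2norm ((σ * (2 * L / N)) • X.col i) ≤ 2 * L := by
      rw [l2norm_smul, abs_mul, hσ, one_mul, abs_of_nonneg (by positivity)]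
      calc 2 * L / N * l2norm (X.col i) ≤ 2 * L / N * N := by
            gcongr; exact l2norm_col_le X i
        _ = 2 * L := by field_simp
    have h2 : l2norm ((σ * (2 * L / N)) • X.col i) ^ 2 ≤ (2 * L) ^ 2 :=
      pow_le_pow_left₀ (l2norm_nonneg _) h1 2
    have h3 : (1 : ℝ) / (p : ℝ) ^ 2 = Real.exp (-(2 * L ^ 2)) := by
      rw [hL2, Real.exp_neg, one_div, two_mul, Real.exp_add, Real.exp_log hp0, sq]
    rw [h3]
    refine Real.exp_le_exp.2 ?_
    nlinarith
  have hsub : (noiseEvent X β₀)ᶜ ⊆ ⋃ i : Fin p,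
      ({Y | 4 * L ^ 2 ≤ (Y - X.mulVec β₀) ⬝ᵥ (((1 : ℝ) * (2 * L / N)) • X.col i)} ∪
       {Y | 4 * L ^ 2 ≤ (Y - X.mulVec β₀) ⬝ᵥ (((-1 : ℝ) * (2 * L / N)) • X.col i)}) := by
    intro Y hY
    simp only [noiseEvent, Set.mem_compl_iff, Set.mem_ofPred_eq, not_forall, not_le] at hY
    obtain ⟨i, hi⟩ := hY
    refine Set.mem_iUnion.2 ⟨i, ?_⟩
    have e1 : 4 * L ^ 2 = 2 * L / N * lamBar X := by
      change _ = 2 * L / N * (2 * N * L)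
      field_simp; ring
    have h2 : 0 ≤ 2 * L / N := by positivity
    simp only [Set.mem_union, Set.mem_ofPred_eq, dotProduct_smul, smul_eq_mul]
    rcases lt_abs.1 hi with h | h
    · left
      rw [e1, one_mul]
      exact mul_le_mul_of_nonneg_left h.le h2
    · right
      rw [e1, neg_one_mul, neg_mul, ← mul_neg]
      exact mul_le_mul_of_nonneg_left h.le h2
  calc dataLaw X β₀ (noiseEvent X β₀)ᶜ ≤ _ := measure_mono hsub
    _ ≤ ∑ i : Fin p, _ := measure_iUnion_fintype_le _ _
    _ ≤ ∑ i : Fin p, (ENNReal.ofReal (1 / (p : ℝ) ^ 2) + ENNReal.ofReal (1 / (p : ℝ) ^ 2)) := by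
        refine Finset.sum_le_sum fun i _ => (measure_union_le _ _).trans (add_le_add ?_ ?_)
        · exact key i 1 (by simp)
        · exact key i (-1) (by simp)
    _ = ENNReal.ofReal (2 / p) := by
        rw [← ENNReal.ofReal_add (by positivity) (by positivity), Finset.sum_const,
          Finset.card_univ, Fintype.card_fin, nsmul_eq_mul, ← ENNReal.ofReal_natCast,
          ← ENNReal.ofReal_mul (by positivity)]
        congr 1; field_simp; ring

/-- Split the linear term `e ⬝ᵥ X h` into fractions `x` and `1 - x` with `x = λ / (2 lamBar)`. On
the noise event the first is at most `(λ / 2) ‖h‖₁`; the second is integrated exactly. Since `1 - (1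
- x)² ≥ x`, a part of the quadratic term proportional to `λ` survives. The point is that the `ℓ¹`
cost is of order `λ` rather than `lamBar`. -/
theorem setLIntegral_likRatio_le {lam : ℝ} (h0 : 0 ≤ lam) (h1 : lam ≤ 2 * lamBar X)
    (hb : 0 < lamBar X) (β₀ h : Fin p → ℝ) :
    ∫⁻ Y in noiseEvent X β₀, ENNReal.ofReal (likRatio X (Y - X.mulVec β₀) h) ∂(dataLaw X β₀) ≤
      ENNReal.ofReal (Real.exp (lam / 2 * l1on Finset.univ h -
        lam / (4 * lamBar X) * l2norm (X.mulVec h) ^ 2)) := by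
  set x := lam / (2 * lamBar X) with hx
  have hx0 : 0 ≤ x := by positivity
  have hx1 : x ≤ 1 := by rw [hx, div_le_one (by positivity)]; exact h1
  have hxl : x * lamBar X = lam / 2 := by rw [hx]; field_simp
  set y := l2norm (X.mulVec h) with hy
  set C := lam / 2 * l1on Finset.univ h - y ^ 2 / 2 with hC
  have hcont : Continuous fun Y : Fin n → ℝ => (Y - X.mulVec β₀) ⬝ᵥ ((1 - x) • X.mulVec h) := by
    fun_prop
  have hmeas := hcont.measurable
  calc ∫⁻ Y in noiseEvent X β₀, ENNReal.ofReal (likRatio X (Y - X.mulVec β₀) h) ∂(dataLaw X β₀)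
      ≤ ∫⁻ Y in noiseEvent X β₀, ENNReal.ofReal (Real.exp C) *
          ENNReal.ofReal (Real.exp ((Y - X.mulVec β₀) ⬝ᵥ ((1 - x) • X.mulVec h)))
            ∂(dataLaw X β₀) := by
        refine setLIntegral_mono (by fun_prop) fun Y hY => ?_
        rw [← ENNReal.ofReal_mul (by positivity), ← Real.exp_add]
        refine ENNReal.ofReal_le_ofReal (Real.exp_le_exp.2 ?_)
        have := (le_abs_self _).trans (abs_dotProduct_mulVec_le X hY h)
        rw [dotProduct_smul, smul_eq_mul, hC, ← hxl]
        nlinarith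
    _ ≤ ∫⁻ Y, ENNReal.ofReal (Real.exp C) *
          ENNReal.ofReal (Real.exp ((Y - X.mulVec β₀) ⬝ᵥ ((1 - x) • X.mulVec h)))
            ∂(dataLaw X β₀) := setLIntegral_le_lintegral _ _
    _ = ENNReal.ofReal (Real.exp (C + ((1 - x) * y) ^ 2 / 2)) := by
        rw [lintegral_const_mul _ (by fun_prop), lintegral_exp_dataLaw,
          ← ENNReal.ofReal_mul (by positivity), ← Real.exp_add, l2norm_smul,
          abs_of_nonneg (by linarith)]
    _ ≤ _ := by
        refine ENNReal.ofReal_le_ofReal (Real.exp_le_exp.2 ?_)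
        have : lam / (4 * lamBar X) = x / 2 := by rw [hx]; field_simp; norm_num
        rw [this, hC]
        have : 0 ≤ x * (1 - x) * y ^ 2 := by
          have := sub_nonneg.2 hx1
          positivity
        nlinarith

end SparseRegression

/-! ### Evidence of a model relative to the truth. -/

namespace SparseRegression

variable {n p : ℕ} (X : Matrix (Fin n) (Fin p) ℝ) {lam : ℝ} [hlam : Fact (0 < lam)]

theorem measurable_likelihood :
    Measurable (fun z : (Fin n → ℝ) × (Fin p → ℝ) => likelihood X z.1 z.2) :=
  (continuous_likelihood X).measurable

theorem measurable_likelihood_right (Y : Fin n → ℝ) : Measurable (fun β => likelihood X Y β) :=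
  (measurable_likelihood X).comp
    (g := fun z : (Fin n → ℝ) × (Fin p → ℝ) => likelihood X z.1 z.2) (f := fun β => (Y, β))
    (by fun_prop)

/-- The marginal likelihood of the model `S`. -/
noncomputable def modelLik (lam : ℝ) (S : Finset (Fin p)) (Y : Fin n → ℝ) : ℝ≥0∞ :=
  ∫⁻ β, likelihood X Y β ∂(slab lam S)

/-- The marginal likelihood of the model `S` relative to the likelihood of `β₀`. -/
noncomputable def relModelLik (lam : ℝ) (β₀ : Fin p → ℝ) (S : Finset (Fin p)) (Y : Fin n → ℝ) :
    ℝ≥0∞ :=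
  ∫⁻ β, ENNReal.ofReal (likRatio X (Y - X.mulVec β₀) (β - β₀)) ∂(slab lam S)

omit hlam in
theorem measurable_ofReal_likRatio {α : Type*} [MeasurableSpace α] {f : α → Fin n → ℝ}
    {g : α → Fin p → ℝ} (hf : Measurable f) (hg : Measurable g) :
    Measurable fun z => ENNReal.ofReal (likRatio X (f z) (g z)) :=
  ENNReal.measurable_ofReal.comp ((continuous_likRatio X).measurable.comp (hf.prodMk hg))

theorem measurable_relModelLik (β₀ : Fin p → ℝ) (S : Finset (Fin p)) :
    Measurable (relModelLik X lam β₀ S) :=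
  Measurable.lintegral_prod_right' (f := fun z : (Fin n → ℝ) × (Fin p → ℝ) =>
    ENNReal.ofReal (likRatio X (z.1 - X.mulVec β₀) (z.2 - β₀)))
    (measurable_ofReal_likRatio X (by fun_prop) (by fun_prop))

omit hlam in
theorem modelLik_eq (β₀ : Fin p → ℝ) (S : Finset (Fin p)) (Y : Fin n → ℝ) :
    modelLik X lam S Y = likelihood X Y β₀ * relModelLik X lam β₀ S Y := by
  rw [modelLik, relModelLik, ← lintegral_const_mul _
    (measurable_ofReal_likRatio X measurable_const (by fun_prop))]
  refine lintegral_congr fun β => ?_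
  rw [← likelihood_add, add_sub_cancel]

omit hlam in
theorem mem_supp {β : Fin p → ℝ} {i : Fin p} : i ∈ supp β ↔ β i ≠ 0 := by simp [supp]

omit hlam in
theorem eq_zero_of_notMem_supp {β : Fin p → ℝ} : ∀ i ∉ supp β, β i = 0 :=
  fun i hi => by simpa [mem_supp] using hi

/-- Recentre the prior at `β₀`, at the cost `exp (-λ ‖β₀‖₁)`, and keep only a box of radius `r`.
There the log likelihood ratio is at least `-1 - 1/2 ≥ -2`, and the Laplace density on the box loses
at most another factor `e`. -/
theorem relModelLik_supp_ge {β₀ : Fin p → ℝ} {r : ℝ} (hr : 0 ≤ r)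
    (hrs : (supp β₀).card * r * (colNorm X + lamBar X + lam) ≤ 1)
    (hb : 0 ≤ lamBar X) {Y : Fin n → ℝ} (hY : Y ∈ noiseEvent X β₀) :
    ENNReal.ofReal (Real.exp (-(lam * l1on Finset.univ β₀)) *
      (Real.exp (-3) * (lam * r) ^ (supp β₀).card)) ≤ relModelLik X lam β₀ (supp β₀) Y := by
  have hl := hlam.out
  have hN := colNorm_nonneg X
  set S := supp β₀ with hS
  have hs0 : (0 : ℝ) ≤ S.card := Nat.cast_nonneg _
  have hsr : 0 ≤ S.card * r := by positivity
  have step1 : ∫⁻ b, ENNReal.ofReal (likRatio X (Y - X.mulVec β₀) b) ∂(slab lam S) ≤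
      ENNReal.ofReal (Real.exp (lam * l1on Finset.univ β₀)) * relModelLik X lam β₀ S Y := by
    have := lintegral_slab_translate_le (lam := lam) S β₀ eq_zero_of_notMem_supp
      (f := fun β => ENNReal.ofReal (likRatio X (Y - X.mulVec β₀) (β - β₀)))
      (measurable_ofReal_likRatio X measurable_const (by fun_prop))
    simpa [relModelLik] using this
  have step2 : ENNReal.ofReal (Real.exp (-2) * (lam * r * Real.exp (-lam * r)) ^ S.card) ≤
      ∫⁻ b, ENNReal.ofReal (likRatio X (Y - X.mulVec β₀) b) ∂(slab lam S) := by
    calc ENNReal.ofReal (Real.exp (-2) * (lam * r * Real.exp (-lam * r)) ^ S.card)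
        ≤ ENNReal.ofReal (Real.exp (-2)) *
          slab lam S (Set.univ.pi fun _ => Set.Icc (-r) r) := by
          rw [ENNReal.ofReal_mul (by positivity)]
          gcongr
          exact slab_box_ge hr S
      _ = ∫⁻ b in Set.univ.pi fun _ => Set.Icc (-r) r, ENNReal.ofReal (Real.exp (-2))
            ∂(slab lam S) := by rw [setLIntegral_const]
      _ ≤ ∫⁻ b in Set.univ.pi fun _ => Set.Icc (-r) r,
            ENNReal.ofReal (likRatio X (Y - X.mulVec β₀) b) ∂(slab lam S) := by
          refine setLIntegral_mono_ae'
            (MeasurableSet.univ_pi fun _ => measurableSet_Icc) ?_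
          filter_upwards [slab_ae_eq_zero S] with b hb0 hbr
          refine ENNReal.ofReal_le_ofReal (Real.exp_le_exp.2 ?_)
          have h1 : l1on Finset.univ b ≤ S.card * r := by
            rw [← l1on_eq_univ hb0, l1on, ← nsmul_eq_mul]
            exact Finset.sum_le_card_nsmul _ _ _ fun i _ => abs_le.2 (hbr i (Set.mem_univ i))
          have h2 := neg_abs_le ((Y - X.mulVec β₀) ⬝ᵥ X.mulVec b)
          have h3 := abs_dotProduct_mulVec_le X hY b
          have h4 : lamBar X * l1on Finset.univ b ≤ 1 :=
            (mul_le_mul_of_nonneg_left h1 hb).trans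
              (by nlinarith [mul_nonneg hsr hN, mul_nonneg hsr hl.le])
          have h5 : colNorm X * l1on Finset.univ b ≤ 1 :=
            (mul_le_mul_of_nonneg_left h1 hN).trans
              (by nlinarith [mul_nonneg hsr hb, mul_nonneg hsr hl.le])
          have h6 := (l2norm_mulVec_le X b).trans h5
          have h7 := l2norm_nonneg (X.mulVec b)
          nlinarith
      _ ≤ _ := setLIntegral_le_lintegral _ _
  have step3 : Real.exp (-3) * (lam * r) ^ S.card ≤
      Real.exp (-2) * (lam * r * Real.exp (-lam * r)) ^ S.card := by
    rw [mul_pow (lam * r), ← Real.exp_nat_mul, mul_left_comm, ← Real.exp_add, mul_comm]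
    refine mul_le_mul_of_nonneg_left (Real.exp_le_exp.2 ?_) (by positivity)
    nlinarith [mul_nonneg hsr hN, mul_nonneg hsr hb]
  calc _ = ENNReal.ofReal (Real.exp (-(lam * l1on Finset.univ β₀))) *
        ENNReal.ofReal (Real.exp (-3) * (lam * r) ^ S.card) := ENNReal.ofReal_mul (by positivity)
    _ ≤ ENNReal.ofReal (Real.exp (-(lam * l1on Finset.univ β₀))) *
        (ENNReal.ofReal (Real.exp (lam * l1on Finset.univ β₀)) * relModelLik X lam β₀ S Y) := by
        gcongr
        exact (ENNReal.ofReal_le_ofReal step3).trans (step2.trans step1)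
    _ = _ := by
        rw [← mul_assoc, ← ENNReal.ofReal_mul (by positivity), ← Real.exp_add, neg_add_cancel,
          Real.exp_zero, ENNReal.ofReal_one, one_mul]

omit hlam in
/-- The basic inequality under compatibility of the true model. -/
theorem cone_inequality {β₀ β : Fin p → ℝ} {c : ℝ} (hl : 0 < lam) (hc : 0 < c)
    (hN : 0 < colNorm X) (hb : 0 < lamBar X)
    (hcone : ∀ h : Fin p → ℝ, l1on (supp β₀)ᶜ h ≤ 7 * l1on (supp β₀) h →
      colNorm X * c * l1on (supp β₀) h ≤ l2norm (X.mulVec h) * √((supp β₀).card : ℝ)) :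
    lam * l1on Finset.univ β₀ + (lam / 2 * l1on Finset.univ (β - β₀) -
        lam / (4 * lamBar X) * l2norm (X.mulVec (β - β₀)) ^ 2) ≤
      lam * l1on Finset.univ β - lam / 4 * l1on Finset.univ (β - β₀) +
        4 * lam * lamBar X * (supp β₀).card / (colNorm X * c) ^ 2 := by
  set S := supp β₀ with hS
  set h := β - β₀ with hh
  set y := l2norm (X.mulVec h)
  set u := l1on S h with hu
  set v := l1on Sᶜ h with hv
  have hu0 : 0 ≤ u := l1on_nonneg _ _
  have hv0 : 0 ≤ v := l1on_nonneg _ _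
  have h1 : l1on Finset.univ h = u + v := (l1on_add_l1on_compl S h).symm
  have h2 : l1on Finset.univ β₀ ≤ l1on S β + u := by
    rw [← l1on_eq_univ (S := S) eq_zero_of_notMem_supp]
    exact l1on_le_l1on_add_sub S β₀ β
  have h3 : l1on Finset.univ β = l1on S β + v := by
    rw [← l1on_add_l1on_compl S β]
    congr 1
    refine Finset.sum_congr rfl fun i hi => ?_
    have : β₀ i = 0 := eq_zero_of_notMem_supp i (Finset.mem_compl.1 hi)
    simp [hh, this]
  set q := (colNorm X * c) ^ 2 with hq
  have hq0 : 0 < q := by positivity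
  set b := lamBar X
  set s : ℝ := (S.card : ℝ) with hs
  have hs0 : 0 ≤ s := Nat.cast_nonneg _
  have hE : 0 ≤ 4 * b * s / q := by positivity
  -- The triangle inequality leaves `(u - v) + (3/4) (u + v) = 7u/4 - v/4`. This is negative outside
  -- the cone `v ≤ 7u`; inside it, compatibility and the arithmetic-geometric mean inequality absorb
  -- `2u` into the quadratic term.
  suffices H : 7 / 4 * u - v / 4 - y ^ 2 / (4 * b) ≤ 4 * b * s / q by
    rw [h1, h3]
    have e1 : lam / (4 * b) * y ^ 2 = lam * (y ^ 2 / (4 * b)) := by ring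
    have e2 : 4 * lam * b * s / q = lam * (4 * b * s / q) := by ring
    rw [e1, e2]
    nlinarith
  have hy2 : 0 ≤ y ^ 2 / (4 * b) := by positivity
  by_cases hc7 : v ≤ 7 * u
  · have h4 := hcone h hc7
    have h5 : q * u ^ 2 ≤ y ^ 2 * s := by
      have := pow_le_pow_left₀ (by positivity) h4 2
      rw [mul_pow _ (√_), Real.sq_sqrt hs0, mul_pow _ u] at this
      exact this
    rcases hs0.eq_or_lt with hs00 | hspos
    · have : u = 0 := by
        rw [← hs00, mul_zero] at h5
        have : u ^ 2 ≤ 0 := by nlinarith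
        nlinarith
      nlinarith
    · have h6 : q * u ^ 2 / (4 * b * s) ≤ y ^ 2 / (4 * b) := by
        rw [div_le_div_iff₀ (by positivity) (by positivity)]
        nlinarith
      have h7 : 2 * u ≤ q * u ^ 2 / (4 * b * s) + 4 * b * s / q := by
        have e : q * u ^ 2 / (4 * b * s) + 4 * b * s / q - 2 * u =
            (q * u - 4 * b * s) ^ 2 / (q * (4 * b * s)) := by
          field_simp
          ring
        have : 0 ≤ (q * u - 4 * b * s) ^ 2 / (q * (4 * b * s)) := by positivity
        linarith
      linarith
  · push Not at hc7
    linarith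

omit hlam in
theorem ofReal_mul_exp_neg_le {a b c : ℝ} (h : a + b ≤ c) :
    ENNReal.ofReal (Real.exp b) ≤
      ENNReal.ofReal (Real.exp (-a)) * ENNReal.ofReal (Real.exp c) := by
  rw [← ENNReal.ofReal_mul (by positivity), ← Real.exp_add]
  exact ENNReal.ofReal_le_ofReal (Real.exp_le_exp.2 (by linarith))

/-- Expected evidence for an arbitrary model. -/
theorem setLIntegral_relModelLik_le {β₀ : Fin p → ℝ} {c : ℝ} (hc : 0 < c)
    (hN : 0 < colNorm X) (hb : 0 < lamBar X) (hlb : lam ≤ 2 * lamBar X)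
    (hcone : ∀ h : Fin p → ℝ, l1on (supp β₀)ᶜ h ≤ 7 * l1on (supp β₀) h →
      colNorm X * c * l1on (supp β₀) h ≤ l2norm (X.mulVec h) * √((supp β₀).card : ℝ))
    (S : Finset (Fin p)) :
    ∫⁻ Y in noiseEvent X β₀, relModelLik X lam β₀ S Y ∂(dataLaw X β₀) ≤
      ENNReal.ofReal (Real.exp (-(lam * l1on Finset.univ β₀)) *
        (Real.exp (4 * lam * lamBar X * (supp β₀).card / (colNorm X * c) ^ 2) *
          4 ^ S.card)) := by
  have hl := hlam.out
  set E := 4 * lam * lamBar X * (supp β₀).card / (colNorm X * c) ^ 2 with hE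
  set a := lam * l1on Finset.univ β₀ with ha
  unfold relModelLik
  rw [lintegral_lintegral_swap
    (measurable_ofReal_likRatio X (by fun_prop) (by fun_prop)).aemeasurable]
  -- The term `-(λ/4) ‖β - β₀‖₁` saved by `cone_inequality` makes the remaining prior integral
  -- finite; each coordinate contributes a factor `4`.
  calc _ ≤ ∫⁻ β, ENNReal.ofReal (Real.exp (-a)) * (ENNReal.ofReal (Real.exp E) *
        ENNReal.ofReal (Real.exp (lam * l1on S β - (1 / 4) * lam * l1on S (β - β₀))))
          ∂(slab lam S) := by
        refine lintegral_mono_ae ?_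
        filter_upwards [slab_ae_eq_zero S] with β hβ
        refine (setLIntegral_likRatio_le X hl.le hlb hb β₀ (β - β₀)).trans ?_
        rw [← ENNReal.ofReal_mul (by positivity), ← Real.exp_add]
        refine ofReal_mul_exp_neg_le ?_
        have h1 := cone_inequality X (β := β) hl hc hN hb hcone
        have h2 := l1on_le_univ S (β - β₀)
        rw [← l1on_eq_univ hβ] at h1
        nlinarith
    _ = _ := by
        rw [lintegral_const_mul _ (by fun_prop), lintegral_const_mul _ (by fun_prop),
          lintegral_slab_tilt (by norm_num), ← ENNReal.ofReal_mul (by positivity),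
          ← ENNReal.ofReal_mul (by positivity)]
        norm_num

/-- Evidence for a model all of whose parameters are far from the truth. -/
theorem relModelLik_le_of_separated {β₀ : Fin p → ℝ} {D : ℝ} (hlb : lam ≤ 2 * lamBar X)
    (S : Finset (Fin p))
    (hsep : ∀ β : Fin p → ℝ, (∀ i ∉ S, β i = 0) →
      5 * lamBar X * l1on Finset.univ (β - β₀) + D ≤ l2norm (X.mulVec (β - β₀)) ^ 2 / 2)
    {Y : Fin n → ℝ} (hY : Y ∈ noiseEvent X β₀) :
    relModelLik X lam β₀ S Y ≤
      ENNReal.ofReal (Real.exp (-(lam * l1on Finset.univ β₀)) * Real.exp (-D)) := by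
  have hl := hlam.out
  set a := lam * l1on Finset.univ β₀ with ha
  calc relModelLik X lam β₀ S Y
      ≤ ∫⁻ β, ENNReal.ofReal (Real.exp (-a)) * (ENNReal.ofReal (Real.exp (-D)) *
        ENNReal.ofReal (Real.exp (lam * l1on S β - 1 * lam * l1on S (β - β₀))))
          ∂(slab lam S) := by
        refine lintegral_mono_ae ?_
        filter_upwards [slab_ae_eq_zero S] with β hβ
        rw [← ENNReal.ofReal_mul (by positivity), ← Real.exp_add]
        refine ofReal_mul_exp_neg_le ?_
        have h1 := (le_abs_self _).trans (abs_dotProduct_mulVec_le X hY (β - β₀))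
        -- Of the five multiples of `lamBar`, one pays for the noise and four pay for `2 λ ‖β -
        -- β₀‖₁`: one `λ` moves `‖β₀‖₁` to `‖β‖₁`, the other makes the tilt integrable.
        have h2 := hsep β hβ
        have h3 := l1on_le_l1on_add_sub Finset.univ β₀ β
        have h4 := l1on_nonneg Finset.univ (β - β₀)
        have h5 := l1on_le_univ S (β - β₀)
        rw [← l1on_eq_univ hβ] at h3
        nlinarith
    _ = _ := by
        rw [lintegral_const_mul _ (by fun_prop), lintegral_const_mul _ (by fun_prop),
          lintegral_slab_tilt (by norm_num), ← ENNReal.ofReal_mul (by positivity)]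
        norm_num [ENNReal.ofReal_mul, Real.exp_nonneg]

end SparseRegression

/-! ### Comparison with supersets, and the posterior mass of the true model. -/

namespace SparseRegression

variable {n p : ℕ} (X : Matrix (Fin n) (Fin p) ℝ) {lam : ℝ} [hlam : Fact (0 < lam)]

omit hlam in
/-- Regressing all columns on those in `S`: the residuals `X (g c + c)` are orthogonal to the
columns in `S`. -/
theorem exists_linear_decorrelation (S : Finset (Fin p)) :
    ∃ g : (Fin p → ℝ) →ₗ[ℝ] (Fin p → ℝ), (∀ c, ∀ i ∉ S, g c i = 0) ∧
      ∀ c b, (∀ i ∉ S, b i = 0) → X.mulVec b ⬝ᵥ X.mulVec (g c + c) = 0 := by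
  let W : Submodule ℝ (Fin p → ℝ) :=
    { carrier := {b | ∀ i ∉ S, b i = 0}
      add_mem' := fun ha hb i hi => by simp [ha i hi, hb i hi]
      zero_mem' := fun i _ => rfl
      smul_mem' := fun c b hb i hi => by simp [hb i hi] }
  let A : (Fin p → ℝ) →ₗ[ℝ] EuclideanSpace ℝ (Fin n) :=
    (WithLp.linearEquiv 2 ℝ (Fin n → ℝ)).symm.toLinearMap ∘ₗ X.mulVecLin
  have hA : ∀ b, A b = WithLp.toLp 2 (X.mulVec b) := fun b => rfl
  -- Only the unit vectors are projected; extending by linear combinations makes `g` linear, hence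
  -- continuous and measurable, even when the projections have nonunique coefficients.
  have key : ∀ j : Fin p, ∃ γ ∈ W, A (γ + Pi.single j 1) ∈ (W.map A)ᗮ := by
    intro j
    obtain ⟨y, hy, z, hz, hyz⟩ := (W.map A).exists_add_mem_mem_orthogonal (A (Pi.single j 1))
    obtain ⟨b, hb, rfl⟩ := hy
    refine ⟨-b, W.neg_mem hb, ?_⟩
    rwa [map_add, hyz, map_neg, neg_add_cancel_left]
  choose γ hγW hγ using key
  refine ⟨Fintype.linearCombination ℝ γ, fun c => ?_, fun c b hb => ?_⟩
  · have : Fintype.linearCombination ℝ γ c ∈ W := by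
      rw [Fintype.linearCombination_apply]
      exact W.sum_mem fun j _ => W.smul_mem _ (hγW j)
    exact this
  · have h1 : Fintype.linearCombination ℝ γ c + c = ∑ j, c j • (γ j + Pi.single j 1) := by
      simp only [smul_add, Finset.sum_add_distrib]
      congr 1
      ext i
      simp [Finset.sum_apply, Pi.single_apply]
    have h2 : A (Fintype.linearCombination ℝ γ c + c) ∈ (W.map A)ᗮ := by
      rw [h1, map_sum]
      refine Submodule.sum_mem _ fun j _ => ?_
      rw [map_smul]
      exact Submodule.smul_mem _ _ (hγ j)
    have h3 := Submodule.inner_left_of_mem_orthogonal (Submodule.mem_map_of_mem (f := A) (p := W) hb) h2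
    rw [hA, hA, EuclideanSpace.inner_toLp_toLp] at h3
    simpa using h3

/-- Bound on the Bayes factor of a larger model against the true one. -/
theorem modelLik_union_le {β₀ : Fin p → ℝ} {T : Finset (Fin p)} (hT : Disjoint (supp β₀) T)
    {g : (Fin p → ℝ) →ₗ[ℝ] (Fin p → ℝ)} (hg : ∀ c, ∀ i ∉ supp β₀, g c i = 0)
    (horth : ∀ c b, (∀ i ∉ supp β₀, b i = 0) → X.mulVec b ⬝ᵥ X.mulVec (g c + c) = 0)
    (Y : Fin n → ℝ) :
    modelLik X lam (supp β₀ ∪ T) Y ≤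
      (∫⁻ c, ENNReal.ofReal (likRatio X (Y - X.mulVec β₀) (g c + c)) *
        ENNReal.ofReal (Real.exp (lam * l1on Finset.univ (g c))) ∂(slab lam T)) *
        modelLik X lam (supp β₀) Y := by
  have hgc : Continuous g := g.continuous_of_finiteDimensional
  have hgm := hgc.measurable
  have hmL := measurable_likelihood_right X Y
  have hK : Measurable fun c => ENNReal.ofReal (likRatio X (Y - X.mulVec β₀) (g c + c)) *
      ENNReal.ofReal (Real.exp (lam * l1on Finset.univ (g c))) :=
    (measurable_ofReal_likRatio X measurable_const (by fun_prop)).mul (by fun_prop)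
  rw [modelLik, lintegral_slab_union hT hmL, ← lintegral_mul_const _ hK]
  refine lintegral_mono fun c => ?_
  have h1 : ∀ᵐ b ∂(slab lam (supp β₀)), likelihood X Y (b + c) =
      ENNReal.ofReal (likRatio X (Y - X.mulVec β₀) (g c + c)) *
        likelihood X Y (b + -g c) := by
    filter_upwards [slab_ae_eq_zero (supp β₀)] with b hb
    rw [show b + c = (b + -g c) + (g c + c) by abel, likelihood_add, mul_comm]
    congr 2
    unfold likRatio
    congr 2
    -- The residual `X (g c + c)` is orthogonal to both `X β₀` and `X (b - g c)`, so the likelihood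
    -- ratio at the centre `b - g c` is that at `β₀` and no longer involves `b`.
    rw [sub_dotProduct, sub_dotProduct, horth c β₀ eq_zero_of_notMem_supp,
      horth c (b + -g c) fun i hi => by simp [hb i hi, hg c i hi]]
  have h2 : l1on Finset.univ (-g c) = l1on Finset.univ (g c) := by simp [l1on]
  rw [lintegral_congr_ae h1, lintegral_const_mul _ (by fun_prop), mul_assoc]
  gcongr
  rw [← h2]
  exact lintegral_slab_translate_le _ _ (fun i hi => by simp [hg c i hi]) hmL

/-- With `h = g c + c`, the expected factor has exponent at most `λ` times `(3/2) ‖h‖₁ - ‖X h‖₂² /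
(4 lamBar)`. Compatibility bounds `‖h‖₁` by a multiple of `‖X h‖₂`, and completing the square gives
a bound uniform in `c`. -/
theorem setLIntegral_bayesFactor_le {β₀ : Fin p → ℝ} {T : Finset (Fin p)}
    (hT : Disjoint (supp β₀) T)
    {g : (Fin p → ℝ) →ₗ[ℝ] (Fin p → ℝ)} (hg : ∀ c, ∀ i ∉ supp β₀, g c i = 0)
    (hb : 0 < lamBar X) (hlb : lam ≤ 2 * lamBar X) {k m : ℝ} (hk : 0 < k) (hm : 0 ≤ m)
    (hcomp : ∀ h : Fin p → ℝ, (∀ i ∉ supp β₀ ∪ T, h i = 0) →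
      k * l1on Finset.univ h ≤ l2norm (X.mulVec h) * √m) :
    ∫⁻ Y in noiseEvent X β₀, (∫⁻ c, ENNReal.ofReal (likRatio X (Y - X.mulVec β₀) (g c + c)) *
        ENNReal.ofReal (Real.exp (lam * l1on Finset.univ (g c))) ∂(slab lam T)) ∂(dataLaw X β₀) ≤
      ENNReal.ofReal (Real.exp (9 / 4 * lam * lamBar X * m / k ^ 2)) := by
  have hl := hlam.out
  have hgc : Continuous g := g.continuous_of_finiteDimensional
  have hgm := hgc.measurable
  rw [lintegral_lintegral_swap
    ((measurable_ofReal_likRatio X (by fun_prop) (by fun_prop)).mul (by fun_prop)).aemeasurable]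
  calc _ ≤ ∫⁻ c, ENNReal.ofReal (Real.exp (9 / 4 * lam * lamBar X * m / k ^ 2)) ∂(slab lam T) := by
        refine lintegral_mono_ae ?_
        filter_upwards [slab_ae_eq_zero T] with c hc
        rw [lintegral_mul_const _ (measurable_ofReal_likRatio X (by fun_prop) (by fun_prop))]
        refine (mul_le_mul_left (setLIntegral_likRatio_le X hl.le hlb hb β₀ (g c + c)) _).trans ?_
        rw [← ENNReal.ofReal_mul (by positivity), ← Real.exp_add]
        refine ENNReal.ofReal_le_ofReal (Real.exp_le_exp.2 ?_)
        set h := g c + c with hh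
        set y := l2norm (X.mulVec h)
        set b := lamBar X
        -- The vectors `g c` and `c` have disjoint supports, so nothing cancels in their sum.
        have h1 : l1on Finset.univ (g c) ≤ l1on Finset.univ h := by
          rw [← l1on_eq_univ (hg c)]
          refine le_trans (le_of_eq ?_) (l1on_le_univ (supp β₀) h)
          refine Finset.sum_congr rfl fun i hi => ?_
          simp [hh, hc i (Finset.disjoint_left.1 hT hi)]
        have h2 := hcomp h fun i hi => by
          rw [Finset.mem_union, not_or] at hi
          simp [hh, hg c i hi.1, hc i hi.2]
        have h3 : l1on Finset.univ h ≤ y * (√m / k) := by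
          rw [← mul_div_assoc, le_div_iff₀ hk]; linarith
        have h4 : (√m / k) ^ 2 = m / k ^ 2 := by rw [div_pow, Real.sq_sqrt hm]
        set κ := √m / k
        have h5 : 3 / 2 * (y * κ) - y ^ 2 / (4 * b) ≤ 9 / 4 * b * κ ^ 2 := by
          have : 9 / 4 * b * κ ^ 2 - (3 / 2 * (y * κ) - y ^ 2 / (4 * b)) =
              (y - 3 * b * κ) ^ 2 / (4 * b) := by
            field_simp; ring
          have : 0 ≤ (y - 3 * b * κ) ^ 2 / (4 * b) := by positivity
          linarith
        have e1 : lam / (4 * b) * y ^ 2 = lam * (y ^ 2 / (4 * b)) := by ring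
        have e2 : 9 / 4 * lam * b * m / k ^ 2 = lam * (9 / 4 * b * κ ^ 2) := by rw [h4]; ring
        rw [e1, e2]
        nlinarith
    _ = _ := by rw [lintegral_const, measure_univ, mul_one]

/-- The prior probability of the model `S`. -/
noncomputable def modelWeight (w : ℕ → ℝ) (S : Finset (Fin p)) : ℝ≥0∞ :=
  ENNReal.ofReal (w S.card / (p.choose S.card : ℝ))

omit hlam in
theorem lintegral_prior (w : ℕ → ℝ) (Y : Fin n → ℝ) :
    ∫⁻ β, likelihood X Y β ∂(prior w lam) =
      ∑ S : Finset (Fin p), modelWeight w S * modelLik X lam S Y := by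
  rw [prior_eq_sum_slab, lintegral_finsetSum_measure]
  simp_rw [lintegral_smul_measure]
  rfl

theorem modelLik_le_one (S : Finset (Fin p)) (Y : Fin n → ℝ) : modelLik X lam S Y ≤ 1 := by
  calc modelLik X lam S Y ≤ ∫⁻ _, 1 ∂(slab lam S) := by
        refine lintegral_mono fun β => ?_
        unfold likelihood
        rw [ENNReal.ofReal_le_one, Real.exp_le_one_iff]
        have := sq_nonneg (l2norm (Y - X.mulVec β))
        linarith
    _ = 1 := by simp

theorem modelLik_pos (S : Finset (Fin p)) (Y : Fin n → ℝ) : 0 < modelLik X lam S Y := by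
  rw [modelLik, lintegral_pos_iff_support (measurable_likelihood_right X Y)]
  have : Function.support (fun β => likelihood X Y β) = Set.univ := by
    ext β
    simp [likelihood, Real.exp_pos]
  rw [this, measure_univ]
  exact one_pos

/-- Only the summand of `supp β₀` is kept, and its draws have exactly that support almost surely. An
inequality is enough. -/
theorem posterior_ge (w : ℕ → ℝ) (β₀ : Fin p → ℝ) (Y : Fin n → ℝ) :
    (∑ S : Finset (Fin p), modelWeight w S * modelLik X lam S Y)⁻¹ *
      (modelWeight w (supp β₀) * modelLik X lam (supp β₀) Y) ≤
      posterior X w lam Y {β | supp β = supp β₀} := by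
  rw [posterior, lintegral_prior, Measure.smul_apply, smul_eq_mul]
  gcongr
  refine le_trans ?_ (withDensity_apply_le _ _)
  rw [prior_eq_sum_slab]
  calc modelWeight w (supp β₀) * modelLik X lam (supp β₀) Y
      = ∫⁻ β in {β | supp β = supp β₀}, likelihood X Y β
          ∂(modelWeight w (supp β₀) • slab lam (supp β₀)) := by
        rw [Measure.restrict_smul, lintegral_smul_measure, smul_eq_mul, modelLik]
        congr 2
        exact (Measure.restrict_eq_self_of_ae_mem (slab_ae_supp_eq (supp β₀))).symm
    _ ≤ _ := by
        refine lintegral_mono' (Measure.restrict_mono le_rfl ?_) le_rfl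
        exact Finset.single_le_sum
          (f := fun S : Finset (Fin p) => modelWeight w S • slab lam S)
          (fun _ _ => Measure.zero_le _) (Finset.mem_univ (supp β₀))

/-- On the noise event the posterior mass of `S` is at most its prior odds times `b S Y` times the
posterior mass of `supp β₀`, and the last factor is at most one. Off the event the trivial bound is
used; integration gives the claim. -/
theorem one_le_trueModelMass_add (w : ℕ → ℝ) (β₀ : Fin p → ℝ)
    (hw : modelWeight w (supp β₀) ≠ 0)
    (b : Finset (Fin p) → (Fin n → ℝ) → ℝ≥0∞) (hbm : ∀ S, Measurable (b S))
    (r : Finset (Fin p) → ℝ≥0∞)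
    (hb : ∀ S, S ≠ supp β₀ → ∀ Y ∈ noiseEvent X β₀,
      modelLik X lam S Y ≤ b S Y * modelLik X lam (supp β₀) Y)
    (hr : ∀ S, S ≠ supp β₀ → ∫⁻ Y in noiseEvent X β₀, b S Y ∂(dataLaw X β₀) ≤ r S) :
    1 ≤ trueModelMass X w lam β₀ + (dataLaw X β₀ (noiseEvent X β₀)ᶜ +
      ∑ S ∈ Finset.univ.erase (supp β₀), modelWeight w S / modelWeight w (supp β₀) * r S) := by
  set S₀ := supp β₀ with hS₀
  have hET := measurableSet_noiseEvent X β₀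
  set G : (Fin n → ℝ) → ℝ≥0∞ := fun Y =>
    ∑ S ∈ Finset.univ.erase S₀, modelWeight w S / modelWeight w S₀ * b S Y with hG
  have hGm : Measurable G := by fun_prop
  have hpt : ∀ Y, 1 ≤ posterior X w lam Y {β | supp β = S₀} +
      ((noiseEvent X β₀)ᶜ.indicator 1 Y + (noiseEvent X β₀).indicator G Y) := by
    intro Y
    by_cases hY : Y ∈ noiseEvent X β₀
    swap
    · rw [Set.indicator_of_mem (by simpa using hY)]
      exact le_add_left (le_add_right le_rfl)
    rw [Set.indicator_of_notMem (by simpa using hY), Set.indicator_of_mem hY, zero_add]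
    refine le_trans ?_ (add_le_add_left (posterior_ge X w β₀ Y) _)
    set D := ∑ S : Finset (Fin p), modelWeight w S * modelLik X lam S Y with hD
    set I := modelLik X lam S₀ Y with hI
    have hI0 : I ≠ 0 := (modelLik_pos X S₀ Y).ne'
    have hDI : modelWeight w S₀ * I ≤ D := Finset.single_le_sum
      (f := fun S : Finset (Fin p) => modelWeight w S * modelLik X lam S Y)
      (fun _ _ => zero_le) (Finset.mem_univ S₀)
    have hD0 : D ≠ 0 := fun h => by
      rw [h, nonpos_iff_eq_zero, mul_eq_zero] at hDI
      exact hDI.elim hw hI0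
    have hDt : D ≠ ∞ := ENNReal.sum_ne_top.2 fun S _ => ENNReal.mul_ne_top ENNReal.ofReal_ne_top
      ((modelLik_le_one X S Y).trans_lt ENNReal.one_lt_top).ne
    have hwt : modelWeight w S₀ ≠ ∞ := ENNReal.ofReal_ne_top
    calc (1 : ℝ≥0∞) = D⁻¹ * D := (ENNReal.inv_mul_cancel hD0 hDt).symm
      _ = D⁻¹ * (modelWeight w S₀ * I) +
          ∑ S ∈ Finset.univ.erase S₀, D⁻¹ * (modelWeight w S * modelLik X lam S Y) := by
          rw [← Finset.mul_sum, ← mul_add,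
            Finset.add_sum_erase _ (fun S => modelWeight w S * modelLik X lam S Y)
              (Finset.mem_univ S₀)]
      _ ≤ _ := by
          refine add_le_add_right (Finset.sum_le_sum fun S hS => ?_) _
          have hne := Finset.ne_of_mem_erase hS
          calc D⁻¹ * (modelWeight w S * modelLik X lam S Y)
              ≤ D⁻¹ * (modelWeight w S * (b S Y * I)) := by gcongr; exact hb S hne Y hY
            _ = (modelWeight w S / modelWeight w S₀ * b S Y) *
                (D⁻¹ * (modelWeight w S₀ * I)) := by
                rw [div_eq_mul_inv]
                calc _ = modelWeight w S * b S Y * D⁻¹ * I *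
                      ((modelWeight w S₀)⁻¹ * modelWeight w S₀) := by
                      rw [ENNReal.inv_mul_cancel hw hwt]; ring
                  _ = _ := by ring
            _ ≤ (modelWeight w S / modelWeight w S₀ * b S Y) * (D⁻¹ * D) := by gcongr
            _ = _ := by rw [ENNReal.inv_mul_cancel hD0 hDt, mul_one]
  calc (1 : ℝ≥0∞) = ∫⁻ _, 1 ∂(dataLaw X β₀) := by simp
    _ ≤ ∫⁻ Y, posterior X w lam Y {β | supp β = S₀} +
      ((noiseEvent X β₀)ᶜ.indicator 1 Y + (noiseEvent X β₀).indicator G Y) ∂(dataLaw X β₀) :=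
        lintegral_mono hpt
    _ = trueModelMass X w lam β₀ + (dataLaw X β₀ (noiseEvent X β₀)ᶜ +
        ∑ S ∈ Finset.univ.erase S₀, modelWeight w S / modelWeight w S₀ *
          ∫⁻ Y in noiseEvent X β₀, b S Y ∂(dataLaw X β₀)) := by
        have hm1 : Measurable ((noiseEvent X β₀)ᶜ.indicator (1 : (Fin n → ℝ) → ℝ≥0∞)) :=
          measurable_one.indicator hET.compl
        have hm2 : Measurable fun Y => (noiseEvent X β₀)ᶜ.indicator (1 : (Fin n → ℝ) → ℝ≥0∞) Y +
            (noiseEvent X β₀).indicator G Y := hm1.add (hGm.indicator hET)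
        rw [lintegral_add_right _ hm2, lintegral_add_left hm1,
          lintegral_indicator_one hET.compl, lintegral_indicator hET, hG,
          lintegral_finsetSum _ (fun S _ => (hbm S).const_mul _)]
        simp_rw [lintegral_const_mul _ (hbm _)]
        rfl
    _ ≤ _ := by
        gcongr with S hS
        exact hr S (Finset.ne_of_mem_erase hS)

end SparseRegression

/-! ### From the compatibility indices and the coordinate lower bounds to regularity of the truth.
-/

namespace SparseRegression

/-- The properties of the design and of the true vector that drive model selection: compatibility
of the true model, compatibility of vectors of comparable dimension, and separation of the
vectors that miss a coordinate of the truth. -/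
structure RegularTruth {n p : ℕ} (X : Matrix (Fin n) (Fin p) ℝ) (A₄ c D : ℝ) (β₀ : Fin p → ℝ) :
    Prop where
  cone : ∀ h : Fin p → ℝ, l1on (supp β₀)ᶜ h ≤ 7 * l1on (supp β₀) h →
    colNorm X * c * l1on (supp β₀) h ≤ l2norm (X.mulVec h) * √((supp β₀).card : ℝ)
  comp : ∀ h : Fin p → ℝ, ((supp h).card : ℝ) ≤ (2 + 3 / A₄) * (supp β₀).card →
    colNorm X * c * l1on Finset.univ h ≤ l2norm (X.mulVec h) * √(5 * (supp β₀).card)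
  sep : ∀ h : Fin p → ℝ, ((supp h).card : ℝ) ≤ (2 + 3 / A₄) * (supp β₀).card →
    ∀ i ∈ supp β₀, |h i| = |β₀ i| →
    5 * lamBar X * l1on Finset.univ h + D ≤ l2norm (X.mulVec h) ^ 2 / 2

variable {n p : ℕ} (X : Matrix (Fin n) (Fin p) ℝ)

/-- Greedy choice: each new sign makes the inner product with the partial sum nonpositive. -/
theorem exists_signs_norm_sum_sq_le {E ι : Type*} [NormedAddCommGroup E] [InnerProductSpace ℝ E]
    [DecidableEq ι] (v : ι → E) (S : Finset ι) :
    ∃ σ : ι → ℝ, (∀ i, |σ i| = 1) ∧ ‖∑ i ∈ S, σ i • v i‖ ^ 2 ≤ ∑ i ∈ S, ‖v i‖ ^ 2 := by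
  induction S using Finset.induction_on with
  | empty => exact ⟨fun _ => 1, by simp⟩
  | insert j S hj ih =>
    obtain ⟨σ, h1, h2⟩ := ih
    set z := ∑ i ∈ S, σ i • v i with hz
    obtain ⟨τ, hτ, hτz⟩ : ∃ τ : ℝ, |τ| = 1 ∧ τ * inner ℝ (v j) z ≤ 0 := by
      rcases le_total (inner ℝ (v j) z) 0 with h | h
      · exact ⟨1, by simp, by linarith⟩
      · exact ⟨-1, by simp, by linarith⟩
    refine ⟨Function.update σ j τ, fun i => ?_, ?_⟩
    · by_cases hij : i = j
      · subst hij; simpa using hτ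
      · simpa [Function.update_of_ne hij] using h1 i
    · have h3 : ∑ i ∈ S, Function.update σ j τ i • v i = z := by
        refine Finset.sum_congr rfl fun i hi => ?_
        rw [Function.update_of_ne (by rintro rfl; exact hj hi)]
      rw [Finset.sum_insert hj, Finset.sum_insert hj, h3, Function.update_self,
        norm_add_sq_real, norm_smul, Real.norm_eq_abs, hτ, one_mul, real_inner_smul_left]
      linarith

theorem mulVec_eq_sum_col (h : Fin p → ℝ) : X.mulVec h = ∑ i, h i • X.col i := by
  rw [Matrix.mulVec_eq_sum]
  simp [Matrix.col]

/-- The test vector has entries `±1` on `S`, with signs chosen so that `‖X h‖₂² ≤ |S| ‖X‖²`. The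
bound allows the index in the denominator of the coordinate threshold to be dropped. -/
theorem compat_le_one (hN : 0 < colNorm X) {S : Finset (Fin p)} (hS : S.Nonempty) :
    compat X S ≤ 1 := by
  obtain ⟨σ, h1, h2⟩ := exists_signs_norm_sum_sq_le (fun i => WithLp.toLp 2 (X.col i)) S
  set h : Fin p → ℝ := fun i => if i ∈ S then σ i else 0 with hh
  have hl : l1on S h = S.card := by
    unfold l1on
    rw [Finset.sum_congr rfl (g := fun _ => (1 : ℝ)) fun i hi => by simp [hh, hi, h1]]
    simp
  have hlc : l1on Sᶜ h = 0 := l1on_eq_zero fun i hi => by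
    simp [hh, Finset.mem_compl.1 hi]
  have hs : (0 : ℝ) < S.card := by exact_mod_cast hS.card_pos
  have hXh : l2norm (X.mulVec h) ≤ √(S.card : ℝ) * colNorm X := by
    refine abs_le_of_sq_le_sq' ?_ (by positivity) |>.2
    rw [mul_pow, Real.sq_sqrt hs.le, mulVec_eq_sum_col, l2norm, WithLp.toLp_sum]
    have : ∑ i, WithLp.toLp 2 (h i • X.col i) = ∑ i ∈ S, σ i • WithLp.toLp 2 (X.col i) := by
      rw [← Finset.sum_subset (Finset.subset_univ S)]
      · exact Finset.sum_congr rfl fun i hi => by simp [hh, hi]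
      · intro i _ hi; simp [hh, hi]
    rw [this]
    refine h2.trans ?_
    rw [← nsmul_eq_mul]
    exact Finset.sum_le_card_nsmul _ _ _ fun i _ =>
      pow_le_pow_left₀ (norm_nonneg _) (l2norm_col_le X i) 2
  have hmem : l1on Sᶜ h ≤ 7 * l1on S h ∧ ∃ i ∈ S, h i ≠ 0 := by
    refine ⟨by rw [hl, hlc]; positivity, ?_⟩
    obtain ⟨i, hi⟩ := hS
    refine ⟨i, hi, fun h0 => ?_⟩
    have := h1 i
    simp only [hh, hi, if_true] at h0
    simp [h0] at this
  refine (iInf₂_le h hmem).trans ?_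
  rw [ENNReal.ofReal_le_one, hl, div_le_one (by positivity)]
  calc l2norm (X.mulVec h) * √(S.card : ℝ) ≤ √(S.card : ℝ) * colNorm X * √(S.card : ℝ) := by
        gcongr
    _ = colNorm X * (√(S.card : ℝ)) ^ 2 := by ring
    _ = _ := by rw [Real.sq_sqrt hs.le]

/-- Only the part `2 + 3 / A₄` of the enlargement is needed; the summand with `φ(S)` is discarded.
-/
theorem ofReal_le_enlargedDim {A₄ : ℝ} (hA : 0 < A₄) (lam : ℝ) (S : Finset (Fin p)) :
    ENNReal.ofReal ((2 + 3 / A₄) * S.card) ≤ enlargedDim X A₄ lam S := by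
  rw [ENNReal.ofReal_mul (by positivity), ENNReal.ofReal_natCast,
    ENNReal.ofReal_add (by norm_num) (by positivity), enlargedDim]
  rw [ENNReal.ofReal_ofNat]
  exact mul_le_mul_left (le_add_right le_rfl) _

theorem natCast_le_enlargedDim {A₄ : ℝ} (hA : 0 < A₄) (lam : ℝ) {S : Finset (Fin p)} {m : ℕ}
    (hm : (m : ℝ) ≤ (2 + 3 / A₄) * S.card) : (m : ℝ≥0∞) ≤ enlargedDim X A₄ lam S := by
  rw [← ENNReal.ofReal_natCast]
  exact (ENNReal.ofReal_le_ofReal hm).trans (ofReal_le_enlargedDim X hA lam S)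

theorem supp_single_one (i : Fin p) : supp (Pi.single i (1 : ℝ)) = {i} := by
  ext j
  by_cases h : j = i
  · subst h; simp [supp]
  · simp [supp, h]

theorem l1on_single_one (i : Fin p) : l1on Finset.univ (Pi.single i (1 : ℝ)) = 1 := by
  rw [← l1on_eq_univ (S := {i}) fun j hj => by
    simp [Finset.mem_singleton.not.1 hj]]
  simp [l1on]

theorem l2norm_single_one (i : Fin p) : l2norm (Pi.single i (1 : ℝ)) = 1 := by
  have : l2norm (Pi.single i (1 : ℝ)) ^ 2 = 1 := by
    rw [l2norm_sq]; simp
  nlinarith [l2norm_nonneg (Pi.single i (1 : ℝ) : Fin p → ℝ)]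

theorem one_le_enlargedDim {A₄ : ℝ} (hA : 0 < A₄) {S : Finset (Fin p)}
    (hS : S.Nonempty) : (1 : ℝ) ≤ (2 + 3 / A₄) * S.card := by
  have h1 : (1 : ℝ) ≤ S.card := by exact_mod_cast hS.card_pos
  have h2 : 0 < 3 / A₄ := by positivity
  nlinarith

theorem single_one_mem {A₄ : ℝ} (hA : 0 < A₄) (lam : ℝ) {S : Finset (Fin p)} (hS : S.Nonempty)
    (i : Fin p) : (supp (Pi.single i (1 : ℝ))).card ≠ 0 ∧
      ((supp (Pi.single i (1 : ℝ))).card : ℝ≥0∞) ≤ enlargedDim X A₄ lam S := by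
  rw [supp_single_one, Finset.card_singleton]
  exact ⟨one_ne_zero, natCast_le_enlargedDim X hA lam (by simpa using one_le_enlargedDim hA hS)⟩

theorem psiTilde_le_one (hN : 0 < colNorm X) {A₄ : ℝ} (hA : 0 < A₄) (lam : ℝ)
    {S : Finset (Fin p)} (hS : S.Nonempty) : psiTilde X A₄ lam S ≤ 1 := by
  obtain ⟨i, hi⟩ := id hS
  refine (iInf₂_le (Pi.single i 1) (single_one_mem X hA lam hS i)).trans ?_
  rw [ENNReal.ofReal_le_one, l2norm_single_one, mul_one, div_le_one hN,
    Matrix.mulVec_single_one]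
  exact l2norm_col_le X i

theorem psiBar_le_one (hN : 0 < colNorm X) {A₄ : ℝ} (hA : 0 < A₄) (lam : ℝ)
    {S : Finset (Fin p)} (hS : S.Nonempty) : psiBar X A₄ lam S ≤ 1 := by
  obtain ⟨i, hi⟩ := id hS
  refine (iInf₂_le (Pi.single i 1) (single_one_mem X hA lam hS i)).trans ?_
  rw [ENNReal.ofReal_le_one, l1on_single_one, supp_single_one, Finset.card_singleton,
    Nat.cast_one, Real.sqrt_one, mul_one, mul_one, div_le_one hN, Matrix.mulVec_single_one]
  exact l2norm_col_le X i

theorem cone_of_le_compat (hN : 0 < colNorm X) {S : Finset (Fin p)} {c : ℝ}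
    (h : ENNReal.ofReal c ≤ compat X S) (β : Fin p → ℝ) (hβ : l1on Sᶜ β ≤ 7 * l1on S β) :
    colNorm X * c * l1on S β ≤ l2norm (X.mulVec β) * √(S.card : ℝ) := by
  have hy := l2norm_nonneg (X.mulVec β)
  rcases (l1on_nonneg S β).eq_or_lt with h0 | h0
  · rw [← h0, mul_zero]; positivity
  · have hex : ∃ i ∈ S, β i ≠ 0 := by
      by_contra hc
      push Not at hc
      exact h0.ne' (l1on_eq_zero hc)
    have h1 := h.trans (iInf₂_le β ⟨hβ, hex⟩)
    rw [ENNReal.ofReal_le_ofReal_iff (by positivity), le_div_iff₀ (by positivity)] at h1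
    linarith

theorem l1on_pos_of_supp {β : Fin p → ℝ} (h : (supp β).card ≠ 0) : 0 < l1on Finset.univ β := by
  obtain ⟨i, hi⟩ := Finset.card_pos.1 (Nat.pos_of_ne_zero h)
  exact (abs_pos.2 (mem_supp.1 hi)).trans_le (abs_le_l1on β (Finset.mem_univ i))

theorem l2norm_pos_of_supp {β : Fin p → ℝ} (h : (supp β).card ≠ 0) : 0 < l2norm β := by
  obtain ⟨i, hi⟩ := Finset.card_pos.1 (Nat.pos_of_ne_zero h)
  exact (abs_pos.2 (mem_supp.1 hi)).trans_le (abs_le_l2norm β i)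

theorem eq_zero_of_card_supp {β : Fin p → ℝ} (h : (supp β).card = 0) : β = 0 := by
  ext i
  exact eq_zero_of_notMem_supp i (by rw [Finset.card_eq_zero.1 h]; simp)

theorem le_of_le_psiBar (hN : 0 < colNorm X) {A₄ : ℝ} (hA : 0 < A₄) {lam : ℝ}
    {S : Finset (Fin p)} {c : ℝ} (h : ENNReal.ofReal c ≤ psiBar X A₄ lam S) (β : Fin p → ℝ)
    (hβ : ((supp β).card : ℝ) ≤ (2 + 3 / A₄) * S.card) :
    colNorm X * c * l1on Finset.univ β ≤ l2norm (X.mulVec β) * √((supp β).card : ℝ) := by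
  have hy := l2norm_nonneg (X.mulVec β)
  by_cases h0 : (supp β).card = 0
  · have : l1on Finset.univ β = 0 := l1on_eq_zero fun i _ => by simp [eq_zero_of_card_supp h0]
    rw [this, mul_zero]; positivity
  · have h1 := h.trans (iInf₂_le β ⟨h0, natCast_le_enlargedDim X hA lam hβ⟩)
    have := l1on_pos_of_supp h0
    rw [ENNReal.ofReal_le_ofReal_iff (by positivity), le_div_iff₀ (by positivity)] at h1
    linarith

theorem le_of_le_psiTilde (hN : 0 < colNorm X) {A₄ : ℝ} (hA : 0 < A₄) {lam : ℝ}
    {S : Finset (Fin p)} {c : ℝ} (h : ENNReal.ofReal c ≤ psiTilde X A₄ lam S) (β : Fin p → ℝ)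
    (hβ : ((supp β).card : ℝ) ≤ (2 + 3 / A₄) * S.card) :
    colNorm X * c * l2norm β ≤ l2norm (X.mulVec β) := by
  have hy := l2norm_nonneg (X.mulVec β)
  by_cases h0 : (supp β).card = 0
  · rw [eq_zero_of_card_supp h0]
    simp [l2norm]
  · have h1 := h.trans (iInf₂_le β ⟨h0, natCast_le_enlargedDim X hA lam hβ⟩)
    have := l2norm_pos_of_supp h0
    rw [ENNReal.ofReal_le_ofReal_iff (by positivity), le_div_iff₀ (by positivity)] at h1
    linarith

theorem l1on_le_sqrt_card_mul_l2norm (β : Fin p → ℝ) :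
    l1on Finset.univ β ≤ √((supp β).card : ℝ) * l2norm β := by
  rw [← l1on_eq_univ (S := supp β) eq_zero_of_notMem_supp]
  refine abs_le_of_sq_le_sq' ?_ (by have := l2norm_nonneg β; positivity) |>.2
  rw [mul_pow, Real.sq_sqrt (Nat.cast_nonneg _), l2norm_sq]
  refine (sq_sum_le_card_mul_sum_sq (s := supp β) (f := fun i => |β i|)).trans ?_
  gcongr
  simp only [sq_abs, dotProduct, ← sq]
  exact Finset.sum_le_univ_sum_of_nonneg fun i => sq_nonneg _

theorem beta_min_real {M N v m : ℝ} {ψ φ : ℝ≥0∞} (hM : 0 ≤ M) (hN : 0 < N)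
    (hφ1 : φ ≤ 1) (hψ0 : ψ ≠ 0) (hψt : ψ ≠ ∞) (hv : 0 ≤ v)
    (h : ENNReal.ofReal M / ψ ^ 2 * (ENNReal.ofReal m / (ENNReal.ofReal N * φ)) ≤
      ENNReal.ofReal v) :
    M * m ≤ ψ.toReal ^ 2 * N * v := by
  have hψ : 0 < ψ.toReal := ENNReal.toReal_pos hψ0 hψt
  have h1 : ENNReal.ofReal (M / ψ.toReal ^ 2 * (m / N)) ≤ ENNReal.ofReal v := by
    refine le_trans ?_ h
    rw [ENNReal.ofReal_mul (by positivity), ENNReal.ofReal_div_of_pos (by positivity),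
      ENNReal.ofReal_div_of_pos hN, ENNReal.ofReal_pow hψ.le, ENNReal.ofReal_toReal hψt]
    gcongr
    exact mul_le_of_le_one_right' hφ1
  rw [ENNReal.ofReal_le_ofReal_iff hv, div_mul_div_comm, div_le_iff₀ (by positivity)] at h1
  linarith

/-- Compatibility gives `ψ lamBar ‖h‖₁ ≲ √(s₀ log p) ‖X h‖₂`, and separation replaces the root by
`(3 ψ / M) ‖X h‖₂`, so `ψ` cancels. It is therefore kept at its actual value here, and is weakened
to `c` only where a fixed constant suffices. -/
theorem regularTruth_of_separation {A₃ A₄ M c ψ : ℝ} {β₀ : Fin p → ℝ} (hN : 0 < colNorm X)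
    (hA₃ : 0 < A₃) (hM : 300 + A₃ ≤ M) (hc : 0 < c) (hcψ : c ≤ ψ) (hψ1 : ψ ≤ 1)
    (cone : ∀ h : Fin p → ℝ, l1on (supp β₀)ᶜ h ≤ 7 * l1on (supp β₀) h →
      colNorm X * c * l1on (supp β₀) h ≤ l2norm (X.mulVec h) * √((supp β₀).card : ℝ))
    (comp : ∀ h : Fin p → ℝ, ((supp h).card : ℝ) ≤ (2 + 3 / A₄) * (supp β₀).card →
      colNorm X * ψ * l1on Finset.univ h ≤ l2norm (X.mulVec h) * √(5 * (supp β₀).card))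
    (sep : ∀ h : Fin p → ℝ, ((supp h).card : ℝ) ≤ (2 + 3 / A₄) * (supp β₀).card →
      ∀ i ∈ supp β₀, |h i| = |β₀ i| →
      M / 3 * √((supp β₀).card * Real.log p) ≤ ψ * l2norm (X.mulVec h)) :
    RegularTruth X A₄ c ((4 + A₃) * ((supp β₀).card * Real.log p)) β₀ where
  cone := cone
  comp h hh := by
    refine le_trans ?_ (comp h hh)
    have := l1on_nonneg Finset.univ h
    gcongr
  sep h hh i hi hhi := by
    have h1 := comp h hh
    have h2 := sep h hh i hi hhi
    set y := l2norm (X.mulVec h)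
    have hy : 0 ≤ y := l2norm_nonneg _
    set N := colNorm X
    set s : ℝ := ((supp β₀).card : ℝ)
    have hs : 0 ≤ s := Nat.cast_nonneg _
    set u := l1on Finset.univ h
    set z := √(s * Real.log p) with hz
    have hz0 : 0 ≤ z := Real.sqrt_nonneg _
    have hz2 : z ^ 2 = s * Real.log p := Real.sq_sqrt (by positivity)
    have hM0 : 0 < M := by linarith
    have hψ : 0 < ψ := by linarith
    have hlb : lamBar X = 2 * N * √(Real.log p) := rfl
    have h5 : √5 ≤ 2.3 := by
      rw [Real.sqrt_le_left (by norm_num)]; norm_num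
    have e1 : √(5 * s) * √(Real.log p) = √5 * z := by
      rw [hz, Real.sqrt_mul (by norm_num), Real.sqrt_mul hs]; ring
    have h3 : ψ * (lamBar X * u) ≤ 4.6 * (z * y) := by
      calc ψ * (lamBar X * u) = 2 * √(Real.log p) * (N * ψ * u) := by rw [hlb]; ring
        _ ≤ 2 * √(Real.log p) * (y * √(5 * s)) := by gcongr
        _ = 2 * (√(5 * s) * √(Real.log p)) * y := by ring
        _ = √5 * (2 * (z * y)) := by rw [e1]; ring
        _ ≤ 2.3 * (2 * (z * y)) := by gcongr
        _ = _ := by ring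
    have h4 : M * z ≤ 3 * (ψ * y) := by linarith
    have h6 : M * (lamBar X * u) ≤ 13.8 * y ^ 2 := by
      have : ψ * (M * (lamBar X * u)) ≤ ψ * (13.8 * y ^ 2) := by
        calc ψ * (M * (lamBar X * u)) = M * (ψ * (lamBar X * u)) := by ring
          _ ≤ M * (4.6 * (z * y)) := by gcongr
          _ = 4.6 * y * (M * z) := by ring
          _ ≤ 4.6 * y * (3 * (ψ * y)) := by gcongr
          _ = _ := by ring
      exact le_of_mul_le_mul_left this hψ
    have h7 : M * z ≤ 3 * y := h4.trans (by nlinarith)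
    have h8 : M ^ 2 * z ^ 2 ≤ 9 * y ^ 2 := by
      have := pow_le_pow_left₀ (by positivity) h7 2
      nlinarith
    have h9 : M * ((4 + A₃) * z ^ 2) ≤ 9 * y ^ 2 := by
      refine le_trans ?_ h8
      have : 4 + A₃ ≤ M := by linarith
      calc M * ((4 + A₃) * z ^ 2) ≤ M * (M * z ^ 2) := by gcongr
        _ = _ := by ring
    rw [← hz2]
    -- The left side is at most `(5 · 13.8 + 9) y² = 78 y²`, and `M ≥ 300` makes the right side at
    -- least `150 y²`.
    have h10 : M * (5 * lamBar X * u + (4 + A₃) * z ^ 2) ≤ M * (y ^ 2 / 2) := by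
      have : 300 * y ^ 2 ≤ M * y ^ 2 := by gcongr; linarith
      nlinarith
    exact le_of_mul_le_mul_left h10 hM0

theorem regularTruth_of_card_eq_zero {A₄ c D : ℝ} {β₀ : Fin p → ℝ} (h0 : (supp β₀).card = 0) :
    RegularTruth X A₄ c D β₀ where
  cone h _ := by
    have : supp β₀ = ∅ := Finset.card_eq_zero.1 h0
    simp [this, l1on]
  comp h hh := by
    rw [h0, Nat.cast_zero, mul_zero] at hh
    have : (supp h).card = 0 := by exact_mod_cast le_antisymm hh (Nat.cast_nonneg _)
    rw [eq_zero_of_card_supp this, h0]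
    simp [l1on]
  sep h _ i hi := by
    rw [Finset.card_eq_zero.1 h0] at hi
    simp at hi

theorem five_mul_ge {A₄ : ℝ} (hA : 1 < A₄) (m : ℕ) : (2 + 3 / A₄) * (m : ℝ) ≤ 5 * m := by
  have : 3 / A₄ ≤ 3 := by rw [div_le_iff₀ (by linarith)]; linarith
  gcongr
  linarith

theorem regularTruth_of_mem_classTilde {A₃ A₄ lam M c₀ s : ℝ} {β₀ : Fin p → ℝ}
    (hN : 0 < colNorm X) (hA₃ : 0 < A₃) (hA₄ : 1 < A₄) (hM : 300 + A₃ ≤ M) (hc₀ : 0 < c₀)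
    (h : β₀ ∈ classTilde X A₄ lam M c₀ s) :
    RegularTruth X A₄ (min c₀ 1) ((4 + A₃) * ((supp β₀).card * Real.log p)) β₀ := by
  obtain ⟨hB, hφ, -, hψ⟩ := h
  by_cases h0 : (supp β₀).card = 0
  · exact regularTruth_of_card_eq_zero X h0
  have hne : (supp β₀).Nonempty := Finset.card_pos.1 (Nat.pos_of_ne_zero h0)
  have hA0 : 0 < A₄ := by linarith
  have hφ1 := compat_le_one X hN hne
  have hψ1 := psiTilde_le_one X hN hA0 lam hne
  have hc : ENNReal.ofReal (min c₀ 1) ≤ ENNReal.ofReal c₀ :=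
    ENNReal.ofReal_le_ofReal (min_le_left _ _)
  set ψ := psiTilde X A₄ lam (supp β₀) with hψdef
  have hψt : ψ ≠ ∞ := (hψ1.trans_lt ENNReal.one_lt_top).ne
  have hψ0 : ψ ≠ 0 := ((ENNReal.ofReal_pos.2 hc₀).trans_le hψ).ne'
  have hψpos : 0 < ψ.toReal := ENNReal.toReal_pos hψ0 hψt
  have hψr : ENNReal.ofReal ψ.toReal ≤ psiTilde X A₄ lam (supp β₀) := by
    rw [ENNReal.ofReal_toReal hψt]
  have hM0 : 0 < M := by linarith
  refine regularTruth_of_separation X hN hA₃ hM (lt_min hc₀ one_pos)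
    ((min_le_left _ _).trans ((ENNReal.ofReal_le_iff_le_toReal hψt).1 hψ))
    (ENNReal.toReal_le_of_le_ofReal zero_le_one (by simpa using hψ1))
    (cone_of_le_compat X hN (hc.trans hφ)) (fun h hh => ?_) (fun h hh i hi hhi => ?_)
  · have h1 := le_of_le_psiTilde X hN hA0 hψr h hh
    have h2 := l1on_le_sqrt_card_mul_l2norm h
    have h3 : √((supp h).card : ℝ) ≤ √(5 * (supp β₀).card) :=
      Real.sqrt_le_sqrt (hh.trans (five_mul_ge hA₄ _))
    have := l2norm_nonneg h
    have := l2norm_nonneg (X.mulVec h)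
    calc colNorm X * ψ.toReal * l1on Finset.univ h
        ≤ colNorm X * ψ.toReal * (√((supp h).card : ℝ) * l2norm h) := by gcongr
      _ = (colNorm X * ψ.toReal * l2norm h) * √((supp h).card : ℝ) := by ring
      _ ≤ _ := by gcongr
  · have h1 := le_of_le_psiTilde X hN hA0 hψr h hh
    have h2 := beta_min_real hM0.le hN hφ1 hψ0 hψt (abs_nonneg _) (hB i hi)
    have h3 : colNorm X * ψ.toReal * |β₀ i| ≤ l2norm (X.mulVec h) := by
      refine le_trans ?_ h1
      rw [← hhi]
      gcongr
      exact abs_le_l2norm h i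
    have h4 : 0 ≤ M * √((supp β₀).card * Real.log p) := by positivity
    have h5 := mul_le_mul_of_nonneg_left h3 hψpos.le
    nlinarith

theorem regularTruth_of_mem_classBar {A₃ A₄ lam M c₀ s : ℝ} {β₀ : Fin p → ℝ}
    (hN : 0 < colNorm X) (hA₃ : 0 < A₃) (hA₄ : 1 < A₄) (hM : 300 + A₃ ≤ M) (hc₀ : 0 < c₀)
    (h : β₀ ∈ classBar X A₄ lam M c₀ s) :
    RegularTruth X A₄ (min c₀ 1) ((4 + A₃) * ((supp β₀).card * Real.log p)) β₀ := by
  obtain ⟨hB, hφ, -, hψ⟩ := h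
  by_cases h0 : (supp β₀).card = 0
  · exact regularTruth_of_card_eq_zero X h0
  have hne : (supp β₀).Nonempty := Finset.card_pos.1 (Nat.pos_of_ne_zero h0)
  have hA0 : 0 < A₄ := by linarith
  have hφ1 := compat_le_one X hN hne
  have hψ1 := psiBar_le_one X hN hA0 lam hne
  have hc : ENNReal.ofReal (min c₀ 1) ≤ ENNReal.ofReal c₀ :=
    ENNReal.ofReal_le_ofReal (min_le_left _ _)
  set ψ := psiBar X A₄ lam (supp β₀) with hψdef
  have hψt : ψ ≠ ∞ := (hψ1.trans_lt ENNReal.one_lt_top).ne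
  have hψ0 : ψ ≠ 0 := ((ENNReal.ofReal_pos.2 hc₀).trans_le hψ).ne'
  have hψpos : 0 < ψ.toReal := ENNReal.toReal_pos hψ0 hψt
  have hψr : ENNReal.ofReal ψ.toReal ≤ psiBar X A₄ lam (supp β₀) := by
    rw [ENNReal.ofReal_toReal hψt]
  have hM0 : 0 < M := by linarith
  have hcomp : ∀ h : Fin p → ℝ, ((supp h).card : ℝ) ≤ (2 + 3 / A₄) * (supp β₀).card →
      colNorm X * ψ.toReal * l1on Finset.univ h ≤
        l2norm (X.mulVec h) * √(5 * (supp β₀).card) := fun h hh => by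
    have h3 : √((supp h).card : ℝ) ≤ √(5 * (supp β₀).card) :=
      Real.sqrt_le_sqrt (hh.trans (five_mul_ge hA₄ _))
    have := l2norm_nonneg (X.mulVec h)
    exact (le_of_le_psiBar X hN hA0 hψr h hh).trans (by gcongr)
  refine regularTruth_of_separation X hN hA₃ hM (lt_min hc₀ one_pos)
    ((min_le_left _ _).trans ((ENNReal.ofReal_le_iff_le_toReal hψt).1 hψ))
    (ENNReal.toReal_le_of_le_ofReal zero_le_one (by simpa using hψ1))
    (cone_of_le_compat X hN (hc.trans hφ)) hcomp (fun h hh i hi hhi => ?_)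
  have h1 := hcomp h hh
  have h2 := beta_min_real hM0.le hN hφ1 hψ0 hψt (abs_nonneg _) (hB i hi)
  have h3 : colNorm X * ψ.toReal * |β₀ i| ≤ l2norm (X.mulVec h) * √(5 * (supp β₀).card) := by
    refine le_trans ?_ h1
    rw [← hhi]
    gcongr
    exact abs_le_l1on h (Finset.mem_univ i)
  set q : ℝ := ((supp β₀).card : ℝ)
  have hq : 0 < q := Nat.cast_pos.2 (Nat.pos_of_ne_zero h0)
  set y := l2norm (X.mulVec h)
  have hy : 0 ≤ y := l2norm_nonneg _
  -- The `ℓ¹` index loses the factor `√(5 s₀)`. Its `√s₀` is compensated by the larger threshold in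
  -- `BBar`; its `√5` is the reason for `M / 3` in `regularTruth_of_separation`.
  have hr5 : √5 ≤ 3 := by rw [Real.sqrt_le_left (by norm_num)]; norm_num
  have h4 : M * (√q * (√q * √(Real.log p))) ≤ √q * (√5 * (ψ.toReal * y)) := by
    calc M * (√q * (√q * √(Real.log p))) = M * (q * √(Real.log p)) := by
          rw [← mul_assoc (√q), Real.mul_self_sqrt hq.le]
      _ ≤ ψ.toReal * (colNorm X * ψ.toReal * |β₀ i|) := by linarith
      _ ≤ ψ.toReal * (y * √(5 * q)) := by gcongr
      _ = _ := by rw [Real.sqrt_mul (by norm_num)]; ring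
  have h5 : M * (√q * √(Real.log p)) ≤ √5 * (ψ.toReal * y) :=
    le_of_mul_le_mul_left (by linarith) (Real.sqrt_pos.2 hq)
  have h6 : √5 * (ψ.toReal * y) ≤ 3 * (ψ.toReal * y) := by gcongr
  rw [Real.sqrt_mul hq.le]
  linarith

end SparseRegression

/-! ### Expected Bayes factors in the three classes of models. -/

namespace SparseRegression

variable {n p : ℕ} (X : Matrix (Fin n) (Fin p) ℝ) {lam : ℝ} [hlam : Fact (0 < lam)]

theorem modelLik_le_relModelLik_mul {β₀ : Fin p → ℝ} {r K : ℝ} (hr : 0 ≤ r) (hK : 0 ≤ K)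
    (hrs : (supp β₀).card * r * (colNorm X + lamBar X + lam) ≤ 1) (hb : 0 ≤ lamBar X)
    (hKr : 1 ≤ K * (lam * r) ^ (supp β₀).card) {Y : Fin n → ℝ} (hY : Y ∈ noiseEvent X β₀)
    (S : Finset (Fin p)) :
    modelLik X lam S Y ≤ relModelLik X lam β₀ S Y *
      ENNReal.ofReal (Real.exp (lam * l1on Finset.univ β₀) * (Real.exp 3 * K)) *
        modelLik X lam (supp β₀) Y := by
  have hl := hlam.out
  rw [modelLik_eq X β₀ S, modelLik_eq X β₀ (supp β₀)]
  have h1 := relModelLik_supp_ge X hr hrs hb hY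
  have h2 : 1 ≤ ENNReal.ofReal (Real.exp (lam * l1on Finset.univ β₀) * (Real.exp 3 * K)) *
      relModelLik X lam β₀ (supp β₀) Y := by
    refine le_trans ?_ (mul_le_mul_right h1 _)
    rw [← ENNReal.ofReal_mul (by positivity), ENNReal.one_le_ofReal]
    calc 1 ≤ K * (lam * r) ^ (supp β₀).card := hKr
      _ = Real.exp (lam * l1on Finset.univ β₀ + 3 + (-(lam * l1on Finset.univ β₀)) + -3) *
          (K * (lam * r) ^ (supp β₀).card) := by ring_nf; simp
      _ = _ := by rw [Real.exp_add, Real.exp_add, Real.exp_add]; ring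
  calc likelihood X Y β₀ * relModelLik X lam β₀ S Y
      = likelihood X Y β₀ * relModelLik X lam β₀ S Y * 1 := (mul_one _).symm
    _ ≤ likelihood X Y β₀ * relModelLik X lam β₀ S Y *
        (ENNReal.ofReal (Real.exp (lam * l1on Finset.univ β₀) * (Real.exp 3 * K)) *
          relModelLik X lam β₀ (supp β₀) Y) := by gcongr
    _ = _ := by ring

open Classical in
/-- Bound for the expected Bayes factor of the model `S` against the true model `S₀`. -/
noncomputable def bayesBound (A₄ K D : ℝ) (S₀ S : Finset (Fin p)) : ℝ :=
  if 3 * (S₀.card : ℝ) < A₄ * (S.card - S₀.card) then Real.exp 4 * K * 4 ^ S.card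
  else if S₀ ⊆ S then Real.exp 1 else Real.exp 3 * K * Real.exp (-D)

-- Explains the enlarged dimension: if `S` is not large, the difference of a vector in `S` and the
-- truth has at most `|S| + |S₀|` nonzero coordinates.
omit hlam in
theorem card_supp_le_of_not_large {A₄ : ℝ} (hA : 0 < A₄) {S₀ S U : Finset (Fin p)}
    (hS : ¬ 3 * (S₀.card : ℝ) < A₄ * (S.card - S₀.card)) (hU : U.card ≤ S.card + S₀.card) :
    (U.card : ℝ) ≤ (2 + 3 / A₄) * S₀.card := by
  have h1 : (S.card : ℝ) - S₀.card ≤ 3 * S₀.card / A₄ := by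
    rw [le_div_iff₀ hA]; linarith
  have h2 : (U.card : ℝ) ≤ S.card + S₀.card := by exact_mod_cast hU
  calc (U.card : ℝ) ≤ 2 * S₀.card + 3 * S₀.card / A₄ := by linarith
    _ = _ := by ring

omit hlam in
theorem supp_subset_of {S : Finset (Fin p)} {h : Fin p → ℝ} (hh : ∀ i ∉ S, h i = 0) :
    supp h ⊆ S := fun i hi => by_contra fun hc => mem_supp.1 hi (hh i hc)

/-- The regression bound is used for supersets that are not large; all other models are compared
through the likelihood of `β₀`, where the factors `exp (±λ ‖β₀‖₁)` cancel. -/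
theorem one_le_trueModelMass_add_sum {A₄ c D r K : ℝ} {w : ℕ → ℝ} {β₀ : Fin p → ℝ}
    (hN : 0 < colNorm X) (hb : 0 < lamBar X) (hlb : lam ≤ 2 * lamBar X) (hA : 0 < A₄)
    (hc : 0 < c) (hp : 1 ≤ p) (hreg : RegularTruth X A₄ c D β₀)
    (hw : modelWeight w (supp β₀) ≠ 0) (hr : 0 ≤ r) (hK : 0 ≤ K)
    (hrs : (supp β₀).card * r * (colNorm X + lamBar X + lam) ≤ 1)
    (hKr : 1 ≤ K * (lam * r) ^ (supp β₀).card)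
    (hE : 12 * lam * lamBar X * (supp β₀).card / (colNorm X * c) ^ 2 ≤ 1) :
    1 ≤ trueModelMass X w lam β₀ + (ENNReal.ofReal (2 / p) +
      ∑ S ∈ Finset.univ.erase (supp β₀), modelWeight w S / modelWeight w (supp β₀) *
        ENNReal.ofReal (bayesBound A₄ K D (supp β₀) S)) := by
  classical
  have hl := hlam.out
  set S₀ := supp β₀ with hS₀
  obtain ⟨g, hg, horth⟩ := exists_linear_decorrelation X S₀
  have hgc : Continuous g := g.continuous_of_finiteDimensional
  have hgm := hgc.measurable
  set Q : Finset (Fin p) → (Fin n → ℝ) → ℝ≥0∞ := fun S Y =>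
    ∫⁻ c, ENNReal.ofReal (likRatio X (Y - X.mulVec β₀) (g c + c)) *
      ENNReal.ofReal (Real.exp (lam * l1on Finset.univ (g c))) ∂(slab lam (S \ S₀)) with hQ
  set a := lam * l1on Finset.univ β₀ with ha
  set R : Finset (Fin p) → (Fin n → ℝ) → ℝ≥0∞ := fun S Y => relModelLik X lam β₀ S Y *
      ENNReal.ofReal (Real.exp a * (Real.exp 3 * K)) with hR
  set P : Finset (Fin p) → Prop := fun S =>
    ¬ 3 * (S₀.card : ℝ) < A₄ * (S.card - S₀.card) ∧ S₀ ⊆ S with hP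
  have hQm : ∀ S, Measurable (Q S) := fun S =>
    Measurable.lintegral_prod_right' (f := fun z : (Fin n → ℝ) × (Fin p → ℝ) =>
      ENNReal.ofReal (likRatio X (z.1 - X.mulVec β₀) (g z.2 + z.2)) *
      ENNReal.ofReal (Real.exp (lam * l1on Finset.univ (g z.2))))
      ((measurable_ofReal_likRatio X (by fun_prop) (by fun_prop)).mul (by fun_prop))
  have hRm : ∀ S, Measurable (R S) := fun S => (measurable_relModelLik X β₀ S).mul_const _
  have key := one_le_trueModelMass_add X (lam := lam) w β₀ hw (fun S => if P S then Q S else R S)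
    (fun S => by by_cases h : P S <;> simp only [h, if_true, if_false, hQm, hRm])
    (fun S => ENNReal.ofReal (bayesBound A₄ K D S₀ S)) ?_ ?_
  · refine key.trans ?_
    gcongr
    exact dataLaw_noiseEvent_compl_le X hN hp β₀
  · intro S hS Y hY
    by_cases h : P S
    · simp only [h, if_true]
      have := modelLik_union_le X (lam := lam) (T := S \ S₀) (β₀ := β₀) Finset.disjoint_sdiff
        hg horth Y
      rwa [Finset.union_sdiff_of_subset h.2] at this
    · simp only [h, if_false]
      exact modelLik_le_relModelLik_mul X hr hK hrs hb.le hKr hY S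
  · intro S hS
    by_cases h : P S
    · simp only [h, if_true]
      rw [bayesBound, if_neg h.1, if_pos h.2]
      refine (setLIntegral_bayesFactor_le X (T := S \ S₀) Finset.disjoint_sdiff hg hb hlb
        (k := colNorm X * c) (m := 5 * S₀.card) (by positivity) (by positivity) ?_).trans ?_
      · intro v hv
        rw [Finset.union_sdiff_of_subset h.2] at hv
        refine hreg.comp v (card_supp_le_of_not_large hA h.1 ?_)
        exact (Finset.card_le_card (supp_subset_of hv)).trans (Nat.le_add_right _ _)
      · refine ENNReal.ofReal_le_ofReal (Real.exp_le_exp.2 (le_trans ?_ hE))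
        gcongr ?_ / _
        -- The constant `12` in `hE` dominates `(9/4) · 5`.
        have : 0 ≤ lam * lamBar X * S₀.card := by positivity
        nlinarith
    · simp only [h, if_false, hR]
      rw [lintegral_mul_const _ (measurable_relModelLik X β₀ S)]
      by_cases h1 : 3 * (S₀.card : ℝ) < A₄ * (S.card - S₀.card)
      · rw [bayesBound, if_pos h1]
        refine (mul_le_mul_left (setLIntegral_relModelLik_le X hc hN hb hlb hreg.cone S) _).trans ?_
        rw [← ENNReal.ofReal_mul (by positivity)]
        refine ENNReal.ofReal_le_ofReal ?_
        have h2 : 4 * lam * lamBar X * S₀.card / (colNorm X * c) ^ 2 ≤ 1 := by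
          refine le_trans ?_ hE
          gcongr
          norm_num
        calc Real.exp (-a) *
              (Real.exp (4 * lam * lamBar X * S₀.card / (colNorm X * c) ^ 2) * 4 ^ S.card) *
              (Real.exp a * (Real.exp 3 * K))
            = (Real.exp (-a) * Real.exp a) *
              (Real.exp (4 * lam * lamBar X * S₀.card / (colNorm X * c) ^ 2) * Real.exp 3) *
                K * 4 ^ S.card := by ring
          _ ≤ 1 * (Real.exp 1 * Real.exp 3) * K * 4 ^ S.card := by
              rw [← Real.exp_add (-a), neg_add_cancel, Real.exp_zero]
              gcongr
          _ = _ := by rw [← Real.exp_add]; norm_num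
      · have h2 : ¬ S₀ ⊆ S := fun h2 => h ⟨h1, h2⟩
        rw [bayesBound, if_neg h1, if_neg h2]
        obtain ⟨i, hi0, hiS⟩ := Finset.not_subset.1 h2
        have hsep : ∀ β : Fin p → ℝ, (∀ i ∉ S, β i = 0) →
            5 * lamBar X * l1on Finset.univ (β - β₀) + D ≤
              l2norm (X.mulVec (β - β₀)) ^ 2 / 2 := by
          intro β hβ
          refine hreg.sep (β - β₀) (card_supp_le_of_not_large hA h1 ?_) i hi0 ?_
          · refine (Finset.card_le_card (supp_subset_of (S := S ∪ S₀) fun j hj => ?_)).trans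
              (Finset.card_union_le _ _)
            rw [Finset.mem_union, not_or] at hj
            simp [hβ j hj.1, eq_zero_of_notMem_supp j hj.2]
          · simp [hβ i hiS]
        calc _ ≤ (∫⁻ _ in noiseEvent X β₀, ENNReal.ofReal (Real.exp (-a) * Real.exp (-D))
                ∂(dataLaw X β₀)) * ENNReal.ofReal (Real.exp a * (Real.exp 3 * K)) := by
              gcongr ?_ * _
              exact setLIntegral_mono measurable_const fun Y hY =>
                relModelLik_le_of_separated X hlb S hsep hY
          _ ≤ ENNReal.ofReal (Real.exp (-a) * Real.exp (-D)) *
                ENNReal.ofReal (Real.exp a * (Real.exp 3 * K)) := by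
              rw [setLIntegral_const]
              gcongr ?_ * _
              exact mul_le_of_le_one_right' prob_le_one
          _ = _ := by
              rw [← ENNReal.ofReal_mul (by positivity)]
              congr 1
              calc _ = (Real.exp (-a) * Real.exp a) * (Real.exp 3 * K * Real.exp (-D)) := by ring
                _ = _ := by rw [← Real.exp_add, neg_add_cancel, Real.exp_zero, one_mul]

end SparseRegression

/-! ### Summation of prior odds times Bayes factors over the models. -/

namespace SparseRegression

theorem sum_pow_le_two {q : ℝ} (h0 : 0 ≤ q) (h1 : q ≤ 1 / 2) (m : ℕ) :
    ∑ t ∈ Finset.range m, q ^ t ≤ 2 := by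
  have h := geom_sum_mul q m
  have := pow_nonneg h0 m
  have h3 : 0 ≤ ∑ t ∈ Finset.range m, q ^ t := Finset.sum_nonneg fun t _ => pow_nonneg h0 t
  nlinarith

theorem sum_pow_succ_le {q : ℝ} (h0 : 0 ≤ q) (h1 : q ≤ 1 / 2) (m : ℕ) :
    ∑ t ∈ Finset.range m, q ^ (t + 1) ≤ 2 * q := by
  simp_rw [pow_succ]
  rw [← Finset.sum_mul]
  exact mul_le_mul_of_nonneg_right (sum_pow_le_two h0 h1 m) h0

namespace IsDimPrior

variable {A₁ A₂ A₃ A₄ : ℝ} {p : ℕ} {w : ℕ → ℝ}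

theorem le_pow_mul (h : IsDimPrior A₁ A₂ A₃ A₄ p w) (hA₂ : 0 ≤ A₂) {s t : ℕ} (hst : s + t ≤ p) :
    w (s + t) ≤ (A₂ * (p : ℝ) ^ (-A₄)) ^ t * w s := by
  induction t with
  | zero => simp
  | succ t ih =>
    have h1 := h.upper (s + t + 1) (by omega) hst
    have h2 := ih (by omega)
    have h3 : 0 ≤ A₂ * (p : ℝ) ^ (-A₄) := by positivity
    calc w (s + (t + 1)) ≤ A₂ * (p : ℝ) ^ (-A₄) * w (s + t) := h1
      _ ≤ A₂ * (p : ℝ) ^ (-A₄) * ((A₂ * (p : ℝ) ^ (-A₄)) ^ t * w s) := by gcongr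
      _ = _ := by ring

theorem pow_mul_zero_le (h : IsDimPrior A₁ A₂ A₃ A₄ p w) (hA₁ : 0 ≤ A₁) {s : ℕ} (hs : s ≤ p) :
    (A₁ * (p : ℝ) ^ (-A₃)) ^ s * w 0 ≤ w s := by
  induction s with
  | zero => simp
  | succ s ih =>
    have h1 := h.lower (s + 1) (by omega) hs
    have h2 := ih (by omega)
    have h3 : 0 ≤ A₁ * (p : ℝ) ^ (-A₃) := by positivity
    calc _ = A₁ * (p : ℝ) ^ (-A₃) * ((A₁ * (p : ℝ) ^ (-A₃)) ^ s * w 0) := by ring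
      _ ≤ A₁ * (p : ℝ) ^ (-A₃) * w s := by gcongr
      _ ≤ _ := h1

/-- The weights are dominated by a geometric sequence of ratio at most `1/2`, whose sum is at most
twice its first term. -/
theorem half_le_zero (h : IsDimPrior A₁ A₂ A₃ A₄ p w) (hA₂ : 0 ≤ A₂)
    (hq : A₂ * (p : ℝ) ^ (-A₄) ≤ 1 / 2) : 1 / 2 ≤ w 0 := by
  have h0 : 0 ≤ A₂ * (p : ℝ) ^ (-A₄) := by positivity
  have hw := h.nonneg 0 (Nat.zero_le _)
  have h1 : ∑ s ∈ Finset.range (p + 1), w s ≤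
      ∑ s ∈ Finset.range (p + 1), (A₂ * (p : ℝ) ^ (-A₄)) ^ s * w 0 := by
    refine Finset.sum_le_sum fun s hs => ?_
    have := h.le_pow_mul hA₂ (s := 0) (t := s) (by have := Finset.mem_range.1 hs; omega)
    rwa [zero_add] at this
  rw [h.sum_eq_one, ← Finset.sum_mul] at h1
  have h2 := mul_le_mul_of_nonneg_right (sum_pow_le_two h0 hq (p + 1)) hw
  linarith

theorem sum_models (h : IsDimPrior A₁ A₂ A₃ A₄ p w) :
    ∑ S : Finset (Fin p), w S.card / (p.choose S.card : ℝ) = 1 := by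
  rw [← Finset.powerset_univ,
    Finset.sum_powerset_apply_card (fun s => w s / (p.choose s : ℝ)), Finset.card_univ,
    Fintype.card_fin, ← h.sum_eq_one]
  refine Finset.sum_congr rfl fun s hs => ?_
  have : (p.choose s : ℝ) ≠ 0 := by
    exact_mod_cast (Nat.choose_pos (by have := Finset.mem_range.1 hs; omega)).ne'
  rw [nsmul_eq_mul]
  field_simp

end IsDimPrior

theorem rpow_natCast_mul' {x : ℝ} (hx : 0 ≤ x) (y : ℝ) (t : ℕ) : (x ^ y) ^ t = x ^ (y * t) := by
  rw [Real.rpow_mul hx, Real.rpow_natCast]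

theorem sum_filter_superset {p : ℕ} (S₀ : Finset (Fin p)) (f : ℕ → ℝ) :
    ∑ S ∈ Finset.univ.filter (fun S => S₀ ⊆ S), f S.card =
      ∑ t ∈ Finset.range (p - S₀.card + 1), ((p - S₀.card).choose t : ℝ) * f (S₀.card + t) := by
  have h1 : ∑ S ∈ Finset.univ.filter (fun S => S₀ ⊆ S), f S.card =
      ∑ T ∈ S₀ᶜ.powerset, f (S₀.card + T.card) := by
    refine Finset.sum_nbij' (fun S => S \ S₀) (fun T => S₀ ∪ T) ?_ ?_ ?_ ?_ ?_
    · intro S _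
      rw [Finset.mem_powerset]
      intro i hi
      simpa using (Finset.mem_sdiff.1 hi).2
    · intro T _
      simp
    · intro S hS
      exact Finset.union_sdiff_of_subset (Finset.mem_filter.1 hS).2
    · intro T hT
      have : Disjoint S₀ T :=
        disjoint_compl_right.mono_right (Finset.mem_powerset.1 hT)
      exact Finset.union_sdiff_cancel_left this
    · intro S hS
      have h := (Finset.mem_filter.1 hS).2
      rw [Finset.card_sdiff_of_subset h, Nat.add_sub_cancel' (Finset.card_le_card h)]
  rw [h1, Finset.sum_powerset_apply_card (fun t => f (S₀.card + t)), Finset.card_compl,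
    Fintype.card_fin]
  simp_rw [nsmul_eq_mul]

variable {A₁ A₂ A₃ A₄ a K D : ℝ} {p : ℕ} {w : ℕ → ℝ}

/-- Contribution of the large models. -/
theorem sum_large_le (h : IsDimPrior A₁ A₂ A₃ A₄ p w) (hA₂ : 0 < A₂) (hA₄ : 1 < A₄)
    (hp : 1 ≤ p) {s₀ : ℕ} (hs₀ : s₀ ≤ p) (hw : 0 < w s₀) (hK : 0 ≤ K)
    (hq : 4 * A₂ * (p : ℝ) ^ (-(1 / 6) : ℝ) ≤ 1 / 2)
    (hKC : K * p.choose s₀ * 4 ^ s₀ ≤ ((p : ℝ) ^ (5 / 2 : ℝ)) ^ s₀) :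
    ∑ S : Finset (Fin p), (if 3 * (s₀ : ℝ) < A₄ * (S.card - s₀) then
      (w S.card / (p.choose S.card : ℝ)) / (w s₀ / (p.choose s₀ : ℝ)) *
        (Real.exp 4 * K * 4 ^ S.card) else 0) ≤
      Real.exp 4 * (2 * (4 * A₂ * (p : ℝ) ^ (-(1 / 6) : ℝ))) := by
  set q := 4 * A₂ * (p : ℝ) ^ (-(1 / 6) : ℝ) with hqdef
  have hP : (1 : ℝ) ≤ p := by exact_mod_cast hp
  have hP0 : (0 : ℝ) < p := by linarith
  have hq0 : 0 ≤ q := by positivity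
  have hC0 : (0 : ℝ) < p.choose s₀ := by exact_mod_cast Nat.choose_pos hs₀
  rw [← Finset.powerset_univ, Finset.sum_powerset_apply_card (fun s : ℕ =>
    if 3 * (s₀ : ℝ) < A₄ * (s - s₀) then (w s / (p.choose s : ℝ)) / (w s₀ / (p.choose s₀ : ℝ)) *
        (Real.exp 4 * K * 4 ^ s) else 0), Finset.card_univ, Fintype.card_fin]
  have hterm : ∀ s ∈ Finset.range (p + 1), p.choose s • (if 3 * (s₀ : ℝ) < A₄ * (s - s₀) then
      (w s / (p.choose s : ℝ)) / (w s₀ / (p.choose s₀ : ℝ)) * (Real.exp 4 * K * 4 ^ s) else 0) ≤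
      if s₀ < s then Real.exp 4 * q ^ (s - s₀) else 0 := by
    intro s hs
    have hsp : s ≤ p := by have := Finset.mem_range.1 hs; omega
    have hC : (0 : ℝ) < p.choose s := by exact_mod_cast Nat.choose_pos hsp
    split_ifs with h1 h2 h2
    · obtain ⟨t, rfl⟩ := Nat.exists_eq_add_of_lt h2
      set u := t + 1 with hu
      have e0 : s₀ + t + 1 = s₀ + u := by omega
      rw [e0] at hsp hC h1 ⊢
      rw [Nat.add_sub_cancel_left, nsmul_eq_mul]
      have h3 : 3 * (s₀ : ℝ) < A₄ * u := by push_cast at h1 ⊢; linarith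
      have h4 := h.le_pow_mul hA₂.le hsp
      have hratio : w (s₀ + u) / w s₀ ≤ (A₂ * (p : ℝ) ^ (-A₄)) ^ u := by
        rw [div_le_iff₀ hw]; exact h4
      calc (p.choose (s₀ + u) : ℝ) * (w (s₀ + u) / (p.choose (s₀ + u) : ℝ) /
              (w s₀ / (p.choose s₀ : ℝ)) * (Real.exp 4 * K * 4 ^ (s₀ + u)))
          = Real.exp 4 * ((w (s₀ + u) / w s₀) * (K * p.choose s₀ * 4 ^ s₀) * 4 ^ u) := by
            rw [pow_add]; field_simp
        _ ≤ Real.exp 4 * ((A₂ * (p : ℝ) ^ (-A₄)) ^ u * ((p : ℝ) ^ (5 / 2 : ℝ)) ^ s₀ * 4 ^ u) := by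
            gcongr
        _ = Real.exp 4 * ((4 * A₂) ^ u * ((p : ℝ) ^ (-A₄ * u + 5 / 2 * s₀))) := by
            rw [mul_pow A₂, rpow_natCast_mul' hP0.le, rpow_natCast_mul' hP0.le,
              Real.rpow_add hP0, mul_pow]
            ring
        _ ≤ Real.exp 4 * ((4 * A₂) ^ u * ((p : ℝ) ^ (-(1 / 6) * (u : ℝ)))) := by
            gcongr
            -- Since `3 s₀ < A₄ u`, the exponent `(5/2) s₀` is less than `(5/6) A₄ u`, which leaves
            -- `-A₄ u / 6 ≤ -u / 6`.
            have : (0 : ℝ) ≤ u := Nat.cast_nonneg _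
            nlinarith
        _ = _ := by rw [hqdef, mul_pow (4 * A₂), rpow_natCast_mul' hP0.le]
    · exfalso
      have : (s : ℝ) ≤ s₀ := by exact_mod_cast not_lt.1 h2
      have h5 : (0 : ℝ) ≤ s₀ := Nat.cast_nonneg _
      nlinarith
    · rw [smul_zero]; positivity
    · rw [smul_zero]
  refine (Finset.sum_le_sum hterm).trans ?_
  rw [← Finset.sum_filter]
  have hfil : (Finset.range (p + 1)).filter (fun s => s₀ < s) = Finset.Ico (s₀ + 1) (p + 1) := by
    ext s; simp; omega
  rw [hfil, Finset.sum_Ico_eq_sum_range, ← Finset.mul_sum]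
  gcongr
  refine le_trans (le_of_eq ?_) (sum_pow_succ_le hq0 hq (p + 1 - (s₀ + 1)))
  exact Finset.sum_congr rfl fun t _ => by congr 1; omega

/-- Contribution of the proper supersets of the true model. -/
theorem sum_superset_le (h : IsDimPrior A₁ A₂ A₃ A₄ p w) (hA₂ : 0 < A₂) (hA₄ : 1 < A₄)
    (hp : 1 ≤ p) {S₀ : Finset (Fin p)} (hw : 0 < w S₀.card)
    (hq : 4 * A₂ * (p : ℝ) ^ (-(1 / 6) : ℝ) ≤ 1 / 2)
    (hsa : (S₀.card : ℝ) ≤ (p : ℝ) ^ a) (ha : a < A₄ - 1) :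
    ∑ S ∈ Finset.univ.filter (fun S => S₀ ⊆ S),
      (if ¬ 3 * (S₀.card : ℝ) < A₄ * (S.card - S₀.card) ∧ S.card ≠ S₀.card then
        (w S.card / (p.choose S.card : ℝ)) / (w S₀.card / (p.choose S₀.card : ℝ)) *
          Real.exp 1 else 0) ≤
      Real.exp 1 * (2 * (4 * A₂ * (p : ℝ) ^ (-(1 / 6) : ℝ))) := by
  set q := 4 * A₂ * (p : ℝ) ^ (-(1 / 6) : ℝ) with hqdef
  have hP : (1 : ℝ) ≤ p := by exact_mod_cast hp
  have hP0 : (0 : ℝ) < p := by linarith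
  have hq0 : 0 ≤ q := by positivity
  have hs₀ : S₀.card ≤ p := by simpa using Finset.card_le_univ S₀
  have hC0 : (0 : ℝ) < p.choose S₀.card := by exact_mod_cast Nat.choose_pos hs₀
  rw [sum_filter_superset S₀ (fun s : ℕ =>
    if ¬ 3 * (S₀.card : ℝ) < A₄ * (s - S₀.card) ∧ s ≠ S₀.card then
        (w s / (p.choose s : ℝ)) / (w S₀.card / (p.choose S₀.card : ℝ)) * Real.exp 1 else 0)]
  rw [Finset.sum_range_succ']
  set s₀ := S₀.card
  have hzero : ((p - s₀).choose 0 : ℝ) * (if ¬ 3 * (s₀ : ℝ) < A₄ * ((s₀ + 0 : ℕ) - s₀) ∧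
      s₀ + 0 ≠ s₀ then (w (s₀ + 0) / (p.choose (s₀ + 0) : ℝ)) / (w s₀ / (p.choose s₀ : ℝ)) *
        Real.exp 1 else 0) = 0 := by simp
  rw [hzero, add_zero]
  refine le_trans (Finset.sum_le_sum (g := fun t => Real.exp 1 * q ^ (t + 1)) fun t ht => ?_) ?_
  · set u := t + 1 with hu
    have hsp : s₀ + u ≤ p := by have := Finset.mem_range.1 ht; omega
    have hC : (0 : ℝ) < p.choose (s₀ + u) := by exact_mod_cast Nat.choose_pos hsp
    split_ifs with h1
    · have h2 : (u : ℝ) ≤ 3 * s₀ := by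
        have h3 := h1.1
        push Not at h3
        push_cast at h3
        have : (0 : ℝ) ≤ u := Nat.cast_nonneg _
        nlinarith
      have hratio : w (s₀ + u) / w s₀ ≤ (A₂ * (p : ℝ) ^ (-A₄)) ^ u := by
        rw [div_le_iff₀ hw]; exact h.le_pow_mul hA₂.le hsp
      -- The number of supersets times the ratio of the model counts is the number of ways to choose
      -- the `u` extra coordinates inside `S`. It is polynomial in `s₀` rather than in `p`, because
      -- `u ≤ 3 s₀`.
      have hchoose : ((p - s₀).choose u : ℝ) * p.choose s₀ =
          p.choose (s₀ + u) * (s₀ + u).choose u := by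
        have := Nat.choose_mul (n := p) (Nat.le_add_right s₀ u)
        rw [Nat.add_sub_cancel_left] at this
        have h4 : (s₀ + u).choose s₀ = (s₀ + u).choose u := Nat.choose_symm_add
        rw [h4] at this
        have h5 : (p.choose (s₀ + u) : ℝ) * (s₀ + u).choose u =
            p.choose s₀ * (p - s₀).choose u := by exact_mod_cast this
        linarith
      have hb : ((s₀ + u).choose u : ℝ) ≤ (4 * (p : ℝ) ^ a) ^ u := by
        calc ((s₀ + u).choose u : ℝ) ≤ ((s₀ + u : ℕ) : ℝ) ^ u := by
              exact_mod_cast Nat.choose_le_pow (s₀ + u) u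
          _ ≤ _ := by
              gcongr
              push_cast
              linarith
      have hexp : a + -A₄ ≤ -(1 / 6) := by linarith
      calc ((p - s₀).choose u : ℝ) * (w (s₀ + u) / (p.choose (s₀ + u) : ℝ) /
              (w s₀ / (p.choose s₀ : ℝ)) * Real.exp 1)
          = Real.exp 1 * ((w (s₀ + u) / w s₀) *
              (((p - s₀).choose u * p.choose s₀) / p.choose (s₀ + u))) := by
            field_simp
        _ = Real.exp 1 * ((w (s₀ + u) / w s₀) * (s₀ + u).choose u) := by
            rw [hchoose]; field_simp
        _ ≤ Real.exp 1 * ((A₂ * (p : ℝ) ^ (-A₄)) ^ u * (4 * (p : ℝ) ^ a) ^ u) := by gcongr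
        _ = Real.exp 1 * (4 * A₂ * (p : ℝ) ^ (a + -A₄)) ^ u := by
            rw [← mul_pow, Real.rpow_add hP0]; ring
        _ ≤ _ := by
            rw [hqdef]
            gcongr
    · rw [mul_zero]; positivity
  · rw [← Finset.mul_sum]
    gcongr
    exact sum_pow_succ_le hq0 hq _

/-- Contribution of the models that miss a coordinate of the truth. -/
theorem sum_not_superset_le (h : IsDimPrior A₁ A₂ A₃ A₄ p w) (hA₁ : 0 < A₁) (hA₂ : 0 < A₂)
    (hp : 1 ≤ p) {s₀ : ℕ} (hs₀ : s₀ ≤ p) (hs₁ : 1 ≤ s₀) (hK : 0 ≤ K)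
    (hq : A₂ * (p : ℝ) ^ (-A₄) ≤ 1 / 2)
    (hKC : K * p.choose s₀ * 4 ^ s₀ ≤ ((p : ℝ) ^ (5 / 2 : ℝ)) ^ s₀)
    (hA₁p : (p : ℝ) ^ (-(1 / 2) : ℝ) ≤ A₁) :
    ∑ S : Finset (Fin p), (w S.card / (p.choose S.card : ℝ)) / (w s₀ / (p.choose s₀ : ℝ)) *
        (Real.exp 3 * K * Real.exp (-((4 + A₃) * (s₀ * Real.log p)))) ≤
      2 * Real.exp 3 / p := by
  have hP : (1 : ℝ) ≤ p := by exact_mod_cast hp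
  have hP0 : (0 : ℝ) < p := by linarith
  have hC0 : (0 : ℝ) < p.choose s₀ := by exact_mod_cast Nat.choose_pos hs₀
  rw [← Finset.sum_mul, ← Finset.sum_div, h.sum_models]
  have hw0 := h.half_le_zero hA₂.le hq
  have hws := h.pow_mul_zero_le hA₁.le hs₀
  have hD : Real.exp (-((4 + A₃) * (s₀ * Real.log p))) = (p : ℝ) ^ (-(4 + A₃) * s₀) := by
    rw [Real.rpow_def_of_pos hP0]; congr 1; ring
  have hAp : 0 < A₁ * (p : ℝ) ^ (-A₃) := by positivity
  have hlow : (A₁ * (p : ℝ) ^ (-A₃)) ^ s₀ * (1 / 2) ≤ w s₀ := by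
    refine le_trans ?_ hws
    gcongr
  have hlow2 : (p : ℝ) ^ (-(1 / 2 + A₃) * s₀) * (1 / 2) ≤ w s₀ := by
    refine le_trans ?_ hlow
    gcongr
    rw [← rpow_natCast_mul' hP0.le]
    gcongr
    rw [show -(1 / 2 + A₃) = -(1 / 2) + -A₃ by ring, Real.rpow_add hP0]
    gcongr
  have hwpos : 0 < w s₀ := lt_of_lt_of_le (by positivity) hlow2
  have hKC2 : K * p.choose s₀ ≤ (p : ℝ) ^ (5 / 2 * (s₀ : ℝ)) := by
    rw [← rpow_natCast_mul' hP0.le]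
    refine le_trans ?_ hKC
    exact le_mul_of_one_le_right (by positivity) (one_le_pow₀ (by norm_num))
  rw [hD]
  calc 1 / (w s₀ / (p.choose s₀ : ℝ)) * (Real.exp 3 * K * (p : ℝ) ^ (-(4 + A₃) * s₀))
      = Real.exp 3 * ((K * p.choose s₀) * (p : ℝ) ^ (-(4 + A₃) * s₀)) / w s₀ := by
        field_simp
    _ ≤ Real.exp 3 * ((p : ℝ) ^ (5 / 2 * (s₀ : ℝ)) * (p : ℝ) ^ (-(4 + A₃) * s₀)) /
        ((p : ℝ) ^ (-(1 / 2 + A₃) * s₀) * (1 / 2)) := by gcongr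
    _ = 2 * Real.exp 3 * (p : ℝ) ^ (-(s₀ : ℝ)) := by
        -- The exponent `4 + A₃` is spent as `5/2` for the evidence, `1/2 + A₃` for the prior weight
        -- of the truth, and `1` left over.
        have e : (p : ℝ) ^ (5 / 2 * (s₀ : ℝ)) * (p : ℝ) ^ (-(4 + A₃) * s₀) =
            (p : ℝ) ^ (-(1 / 2 + A₃) * s₀) * (p : ℝ) ^ (-(s₀ : ℝ)) := by
          rw [← Real.rpow_add hP0, ← Real.rpow_add hP0]
          congr 1; ring
        rw [e]
        have : (p : ℝ) ^ (-(1 / 2 + A₃) * s₀) ≠ 0 := by positivity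
        field_simp
    _ ≤ 2 * Real.exp 3 * (p : ℝ) ^ (-1 : ℝ) := by
        gcongr
        exact_mod_cast hs₁
    _ = _ := by rw [Real.rpow_neg_one]; rfl

theorem sum_bayesBound_le (h : IsDimPrior A₁ A₂ A₃ A₄ p w) (hA₁ : 0 < A₁) (hA₂ : 0 < A₂)
    (hA₄ : 1 < A₄) (hp : 1 ≤ p) {S₀ : Finset (Fin p)} (hK : 0 ≤ K)
    (hq : 4 * A₂ * (p : ℝ) ^ (-(1 / 6) : ℝ) ≤ 1 / 2)
    (hKC : K * p.choose S₀.card * 4 ^ S₀.card ≤ ((p : ℝ) ^ (5 / 2 : ℝ)) ^ S₀.card)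
    (hA₁p : (p : ℝ) ^ (-(1 / 2) : ℝ) ≤ A₁)
    (hsa : (S₀.card : ℝ) ≤ (p : ℝ) ^ a) (ha : a < A₄ - 1) :
    modelWeight w S₀ ≠ 0 ∧
    ∑ S ∈ Finset.univ.erase S₀, modelWeight w S / modelWeight w S₀ *
        ENNReal.ofReal (bayesBound A₄ K ((4 + A₃) * (S₀.card * Real.log p)) S₀ S) ≤
      ENNReal.ofReal (Real.exp 4 * (2 * (4 * A₂ * (p : ℝ) ^ (-(1 / 6) : ℝ))) +
        (Real.exp 1 * (2 * (4 * A₂ * (p : ℝ) ^ (-(1 / 6) : ℝ))) + 2 * Real.exp 3 / p)) := by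
  classical
  have hP : (1 : ℝ) ≤ p := by exact_mod_cast hp
  have hP0 : (0 : ℝ) < p := by linarith
  have hs₀ : S₀.card ≤ p := by simpa using Finset.card_le_univ S₀
  have hq2 : A₂ * (p : ℝ) ^ (-A₄) ≤ 1 / 2 := by
    calc A₂ * (p : ℝ) ^ (-A₄) ≤ A₂ * (p : ℝ) ^ (-(1 / 6) : ℝ) := by
          gcongr
          linarith
      _ ≤ 4 * A₂ * (p : ℝ) ^ (-(1 / 6) : ℝ) := by
          have : 0 ≤ A₂ * (p : ℝ) ^ (-(1 / 6) : ℝ) := by positivity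
          linarith
      _ ≤ _ := hq
  have hw0 := h.half_le_zero hA₂.le hq2
  have hw : 0 < w S₀.card := by
    have := h.pow_mul_zero_le hA₁.le hs₀
    have h2 : 0 < (A₁ * (p : ℝ) ^ (-A₃)) ^ S₀.card * w 0 := by positivity
    linarith
  have hC0 : (0 : ℝ) < p.choose S₀.card := by exact_mod_cast Nat.choose_pos hs₀
  have hwt : 0 < w S₀.card / (p.choose S₀.card : ℝ) := by positivity
  refine ⟨(ENNReal.ofReal_pos.2 hwt).ne', ?_⟩
  set D := (4 + A₃) * (S₀.card * Real.log p) with hD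
  set ratio : Finset (Fin p) → ℝ := fun S =>
    (w S.card / (p.choose S.card : ℝ)) / (w S₀.card / (p.choose S₀.card : ℝ)) with hratio
  have hr0 : ∀ S, 0 ≤ ratio S := fun S => by
    have := h.nonneg S.card (by simpa using Finset.card_le_univ S)
    positivity
  have hb0 : ∀ S, 0 ≤ bayesBound A₄ K D S₀ S := fun S => by
    unfold bayesBound; split_ifs <;> positivity
  set f₁ : Finset (Fin p) → ℝ := fun S => if 3 * (S₀.card : ℝ) < A₄ * (S.card - S₀.card) then
      ratio S * (Real.exp 4 * K * 4 ^ S.card) else 0 with hf₁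
  set f₂ : Finset (Fin p) → ℝ := fun S =>
      if ¬ 3 * (S₀.card : ℝ) < A₄ * (S.card - S₀.card) ∧ S.card ≠ S₀.card then
        ratio S * Real.exp 1 else 0 with hf₂
  set f₃ : Finset (Fin p) → ℝ := fun S =>
      if S₀ ⊆ S then 0 else ratio S * (Real.exp 3 * K * Real.exp (-D)) with hf₃
  have hf₁0 : ∀ S, 0 ≤ f₁ S := fun S => by
    have := hr0 S
    simp only [hf₁]; split_ifs <;> positivity
  have hf₂0 : ∀ S, 0 ≤ f₂ S := fun S => by
    have := hr0 S
    simp only [hf₂]; split_ifs <;> positivity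
  have hf₃0 : ∀ S, 0 ≤ f₃ S := fun S => by
    have := hr0 S
    simp only [hf₃]; split_ifs <;> positivity
  have hterm : ∀ S ∈ Finset.univ.erase S₀, ratio S * bayesBound A₄ K D S₀ S ≤
      f₁ S + ((if S₀ ⊆ S then f₂ S else 0) + f₃ S) := by
    intro S hS
    have hne := Finset.ne_of_mem_erase hS
    by_cases h1 : 3 * (S₀.card : ℝ) < A₄ * (S.card - S₀.card)
    · have e : ratio S * bayesBound A₄ K D S₀ S = f₁ S := by
        simp only [hf₁, bayesBound, if_pos h1]
      rw [e]
      have h3 : 0 ≤ (if S₀ ⊆ S then f₂ S else 0) := by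
        split_ifs
        · exact hf₂0 S
        · exact le_rfl
      linarith [hf₃0 S]
    · by_cases h2 : S₀ ⊆ S
      · have h3 : S.card ≠ S₀.card := fun hc => hne (Finset.eq_of_subset_of_card_le h2 hc.le).symm
        have e : ratio S * bayesBound A₄ K D S₀ S = f₂ S := by
          simp only [hf₂, bayesBound]
          rw [if_neg h1, if_pos h2, if_pos ⟨h1, h3⟩]
        rw [e, if_pos h2]
        linarith [hf₁0 S, hf₃0 S]
      · have e : ratio S * bayesBound A₄ K D S₀ S = f₃ S := by
          simp only [hf₃, bayesBound]
          rw [if_neg h1, if_neg h2, if_neg h2]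
        rw [e, if_neg h2]
        linarith [hf₁0 S]
  have hsum₁ := sum_large_le h hA₂ hA₄ hp hs₀ hw hK hq hKC
  have hsum₂ := sum_superset_le h hA₂ hA₄ hp hw hq hsa ha
  have hsum₃ : ∑ S, f₃ S ≤ 2 * Real.exp 3 / p := by
    rcases Nat.eq_zero_or_pos S₀.card with h0 | hpos
    · have : ∀ S, f₃ S = 0 := fun S => by
        simp [hf₃, Finset.card_eq_zero.1 h0]
      simp only [this, Finset.sum_const_zero]
      positivity
    · refine le_trans (Finset.sum_le_sum fun S _ => ?_)
        (sum_not_superset_le h hA₁ hA₂ hp hs₀ hpos hK hq2 hKC hA₁p)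
      simp only [hf₃]
      have := hr0 S
      split_ifs
      · positivity
      · exact le_rfl
  calc ∑ S ∈ Finset.univ.erase S₀, modelWeight w S / modelWeight w S₀ *
        ENNReal.ofReal (bayesBound A₄ K D S₀ S)
      = ENNReal.ofReal (∑ S ∈ Finset.univ.erase S₀, ratio S * bayesBound A₄ K D S₀ S) := by
        rw [ENNReal.ofReal_sum_of_nonneg fun S _ => mul_nonneg (hr0 S) (hb0 S)]
        refine Finset.sum_congr rfl fun S _ => ?_
        rw [ENNReal.ofReal_mul (hr0 S), modelWeight, modelWeight, ENNReal.ofReal_div_of_pos hwt]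
    _ ≤ _ := by
        refine ENNReal.ofReal_le_ofReal ?_
        calc ∑ S ∈ Finset.univ.erase S₀, ratio S * bayesBound A₄ K D S₀ S
            ≤ ∑ S ∈ Finset.univ.erase S₀, (f₁ S + ((if S₀ ⊆ S then f₂ S else 0) + f₃ S)) :=
              Finset.sum_le_sum hterm
          _ ≤ ∑ S, (f₁ S + ((if S₀ ⊆ S then f₂ S else 0) + f₃ S)) := by
              refine Finset.sum_le_sum_of_subset_of_nonneg (Finset.erase_subset _ _) fun S _ _ => ?_
              have h3 : 0 ≤ (if S₀ ⊆ S then f₂ S else 0) := by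
                split_ifs
                · exact hf₂0 S
                · exact le_rfl
              linarith [hf₃0 S, hf₁0 S]
          _ ≤ _ := by
              rw [Finset.sum_add_distrib, Finset.sum_add_distrib,
                ← Finset.sum_filter (fun S => S₀ ⊆ S) f₂]
              exact add_le_add hsum₁ (add_le_add hsum₂ hsum₃)

/-- The normalizing constant of the lower bound for the evidence of the true model. -/
theorem choose_mul_inv_pow_le {N L lam : ℝ} (hlam : 0 < lam) (hN : 0 < N) (hL : 1 ≤ L)
    (hp : 1 ≤ p) (h1 : N / p ≤ lam) (h2 : lam ≤ 4 * N * L)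
    (hbig : 28 * Real.exp 1 * L ≤ (p : ℝ) ^ (1 / 2 : ℝ)) (s : ℕ) :
    ((lam * (1 / (s * (N + 2 * N * L + lam)))) ^ s)⁻¹ * p.choose s * 4 ^ s ≤
      ((p : ℝ) ^ (5 / 2 : ℝ)) ^ s := by
  have hP : (1 : ℝ) ≤ p := by exact_mod_cast hp
  have hP0 : (0 : ℝ) < p := by linarith
  rcases Nat.eq_zero_or_pos s with rfl | hs
  · simp
  have hs' : (0 : ℝ) < s := by exact_mod_cast hs
  have hx : (lam * (1 / (s * (N + 2 * N * L + lam))))⁻¹ ≤ s * (7 * L * p) := by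
    rw [mul_one_div, inv_div, div_le_iff₀ hlam]
    have h3 : N ≤ lam * p := (div_le_iff₀ hP0).1 h1
    -- As `L ≥ 1` and `λ ≤ 4 N L`, the three terms are at most `1`, `2` and `4` times `N L`.
    have h4 : N + 2 * N * L + lam ≤ N * (7 * L) := by nlinarith
    calc s * (N + 2 * N * L + lam) ≤ s * (N * (7 * L)) := by gcongr
      _ ≤ s * ((lam * p) * (7 * L)) := by gcongr
      _ = _ := by ring
  have hch : (p.choose s : ℝ) ≤ (p : ℝ) ^ s / s.factorial := Nat.choose_le_pow_div s p
  -- The factor `s ^ s` from the radius of the box is absorbed by the `s!` in the binomial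
  -- coefficient.
  have hfac : (s : ℝ) ^ s / s.factorial ≤ Real.exp 1 ^ s := by
    rw [← Real.exp_nat_mul, mul_one]
    exact Real.pow_div_factorial_le_exp _ hs'.le s
  rw [← inv_pow]
  calc ((lam * (1 / (s * (N + 2 * N * L + lam))))⁻¹) ^ s * p.choose s * 4 ^ s
      ≤ (s * (7 * L * p)) ^ s * ((p : ℝ) ^ s / s.factorial) * 4 ^ s := by gcongr
    _ = ((s : ℝ) ^ s / s.factorial) * (28 * L * p ^ 2) ^ s := by
        rw [show (28 * L * p ^ 2 : ℝ) = (7 * L * p) * p * 4 by ring, mul_pow, mul_pow _ (4 : ℝ),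
          mul_pow _ (p : ℝ)]
        ring
    _ ≤ Real.exp 1 ^ s * (28 * L * p ^ 2) ^ s := by gcongr
    _ = (28 * Real.exp 1 * L * p ^ 2) ^ s := by rw [← mul_pow]; ring
    _ ≤ ((p : ℝ) ^ (1 / 2 : ℝ) * p ^ 2) ^ s := by gcongr
    _ = _ := by
        congr 1
        rw [← Real.rpow_natCast (p : ℝ) 2, ← Real.rpow_add hP0]
        norm_num

end SparseRegression

/-! ### The error for one sample size, and the limit. -/

namespace SparseRegression

/-- Bound for the expected posterior mass of the wrong models. -/
noncomputable def selectionError (A₂ x : ℝ) : ℝ :=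
  2 / x + (Real.exp 4 * (2 * (4 * A₂ * x ^ (-(1 / 6) : ℝ))) +
    (Real.exp 1 * (2 * (4 * A₂ * x ^ (-(1 / 6) : ℝ))) + 2 * Real.exp 3 / x))

theorem tendsto_selectionError (A₂ : ℝ) : Tendsto (selectionError A₂) atTop (𝓝 0) := by
  have h1 : Tendsto (fun x : ℝ => x ^ (-(1 / 6) : ℝ)) atTop (𝓝 0) :=
    tendsto_rpow_neg_atTop (by norm_num)
  have h2 : Tendsto (fun x : ℝ => 2 / x) atTop (𝓝 0) := tendsto_id.const_div_atTop 2
  have h3 : Tendsto (fun x : ℝ => 2 * Real.exp 3 / x) atTop (𝓝 0) :=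
    tendsto_id.const_div_atTop _
  have h4 := ((h1.const_mul (4 * A₂)).const_mul 2)
  have := h2.add ((h4.const_mul (Real.exp 4)).add ((h4.const_mul (Real.exp 1)).add h3))
  simp only [mul_zero, add_zero] at this
  exact this

/-- The dimension is large enough for the bounds on the prior odds. -/
structure LargeDim (A₁ A₂ x : ℝ) : Prop where
  one_le_log : 1 ≤ Real.log x
  sqrt_log_le : 28 * Real.exp 1 * √(Real.log x) ≤ x ^ (1 / 2 : ℝ)
  ratio_le : 4 * A₂ * x ^ (-(1 / 6) : ℝ) ≤ 1 / 2
  rpow_le : x ^ (-(1 / 2) : ℝ) ≤ A₁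

theorem eventually_largeDim {A₁ : ℝ} (A₂ : ℝ) (hA₁ : 0 < A₁) :
    ∀ᶠ x in atTop, LargeDim A₁ A₂ x := by
  have h1 := Real.tendsto_log_atTop.eventually_ge_atTop 1
  have h2 : ∀ᶠ x : ℝ in atTop, 28 * Real.exp 1 * √(Real.log x) ≤ x ^ (1 / 2 : ℝ) := by
    have h := (isLittleO_log_rpow_atTop (r := 1 / 2) (by norm_num)).bound
      (c := (28 * Real.exp 1)⁻¹) (by positivity)
    filter_upwards [h, h1, eventually_ge_atTop 0] with x hx hx1 hx0
    rw [Real.norm_of_nonneg (by linarith), Real.norm_of_nonneg (by positivity)] at hx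
    have h3 : √(Real.log x) ≤ Real.log x := by
      rw [Real.sqrt_le_left (by linarith)]
      nlinarith
    calc 28 * Real.exp 1 * √(Real.log x) ≤ 28 * Real.exp 1 * Real.log x := by gcongr
      _ ≤ 28 * Real.exp 1 * ((28 * Real.exp 1)⁻¹ * x ^ (1 / 2 : ℝ)) := by gcongr
      _ = _ := by field_simp
  have h3 : ∀ᶠ x : ℝ in atTop, 4 * A₂ * x ^ (-(1 / 6) : ℝ) ≤ 1 / 2 := by
    have h : Tendsto (fun x : ℝ => 4 * A₂ * x ^ (-(1 / 6) : ℝ)) atTop (𝓝 (4 * A₂ * 0)) :=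
      (tendsto_rpow_neg_atTop (by norm_num)).const_mul _
    rw [mul_zero] at h
    exact h.eventually_le_const (by norm_num)
  have h4 : ∀ᶠ x : ℝ in atTop, x ^ (-(1 / 2) : ℝ) ≤ A₁ :=
    (tendsto_rpow_neg_atTop (by norm_num)).eventually_le_const hA₁
  filter_upwards [h1, h2, h3, h4] with x a b c d using ⟨a, b, c, d⟩

variable {n p : ℕ} (X : Matrix (Fin n) (Fin p) ℝ)

/-- The constant `c` enters only through the requirement that `s λ √(log p) / ‖X‖` be small; the
error is the same for all admissible truths. -/
theorem one_le_trueModelMass_add_selectionError {A₁ A₂ A₃ A₄ lam a c s : ℝ} {w : ℕ → ℝ}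
    (hA₁ : 0 < A₁) (hA₂ : 0 < A₂) (hA₄ : 1 < A₄) (hlam : 0 < lam)
    (hl1 : colNorm X / p ≤ lam) (hl2 : lam ≤ 2 * lamBar X) (hpr : IsDimPrior A₁ A₂ A₃ A₄ p w)
    (ha : a < A₄ - 1) (hsa : s ≤ (p : ℝ) ^ a) (hc : 0 < c)
    (hs : s * lam * √(Real.log p) / colNorm X ≤ c ^ 2 / 24)
    (hdim : LargeDim A₁ A₂ p) {β₀ : Fin p → ℝ} (hcard : ((supp β₀).card : ℝ) ≤ s)
    (hreg : RegularTruth X A₄ c ((4 + A₃) * ((supp β₀).card * Real.log p)) β₀) :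
    1 ≤ trueModelMass X w lam β₀ + ENNReal.ofReal (selectionError A₂ p) := by
  have : Fact (0 < lam) := ⟨hlam⟩
  have hb : 0 < lamBar X := by linarith
  have hp : 1 ≤ p := by
    rcases Nat.eq_zero_or_pos p with h | h
    · have := hdim.one_le_log
      rw [h] at this
      norm_num at this
    · exact h
  have hP : (1 : ℝ) ≤ p := by exact_mod_cast hp
  set L := √(Real.log p) with hL
  have hL1 : 1 ≤ L := Real.one_le_sqrt.2 hdim.one_le_log
  have hlb : lamBar X = 2 * colNorm X * L := rfl
  have hN : 0 < colNorm X := by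
    refine (colNorm_nonneg X).lt_of_ne fun h => ?_
    rw [hlb, ← h] at hb
    simp at hb
  set N := colNorm X with hNdef
  set s₀ := (supp β₀).card with hs₀
  -- The largest radius allowed by the box bound. For the empty model division by zero gives `r =
  -- 0`, which is harmless because `(λ r) ^ 0 = 1`.
  set r := 1 / (s₀ * (N + 2 * N * L + lam)) with hr
  have hr0 : 0 ≤ r := by positivity
  have hrpow : 0 < (lam * r) ^ s₀ := by
    rcases Nat.eq_zero_or_pos s₀ with h | h
    · rw [h, pow_zero]; exact one_pos
    · have : (0 : ℝ) < s₀ := by exact_mod_cast h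
      positivity
  set K := ((lam * r) ^ s₀)⁻¹ with hK
  have hK0 : 0 ≤ K := by positivity
  have hKC : K * p.choose s₀ * 4 ^ s₀ ≤ ((p : ℝ) ^ (5 / 2 : ℝ)) ^ s₀ :=
    choose_mul_inv_pow_le hlam hN hL1 hp hl1 (by rw [hlb] at hl2; linarith) hdim.sqrt_log_le s₀
  obtain ⟨hw, hsum⟩ := sum_bayesBound_le (S₀ := supp β₀) hpr hA₁ hA₂ hA₄ hp hK0 hdim.ratio_le hKC
    hdim.rpow_le (hcard.trans hsa) ha
  have hrs : s₀ * r * (N + lamBar X + lam) ≤ 1 := by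
    rw [hr, hlb]
    rcases Nat.eq_zero_or_pos s₀ with h | h
    · rw [h]; simp
    · have : (0 : ℝ) < s₀ := by exact_mod_cast h
      apply le_of_eq
      have h2 : N + 2 * N * L + lam ≠ 0 := by positivity
      field_simp
  have hE : 12 * lam * lamBar X * s₀ / (N * c) ^ 2 ≤ 1 := by
    have h1 : s₀ * lam * L / N ≤ c ^ 2 / 24 := by
      refine le_trans ?_ hs
      gcongr
    calc 12 * lam * lamBar X * s₀ / (N * c) ^ 2 = 24 / c ^ 2 * (s₀ * lam * L / N) := by
          rw [hlb]; field_simp; ring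
      _ ≤ 24 / c ^ 2 * (c ^ 2 / 24) := by gcongr
      _ = 1 := by field_simp
  refine (one_le_trueModelMass_add_sum X hN hb hl2 (by linarith) hc hp hreg hw hr0 hK0 hrs
    (inv_mul_cancel₀ hrpow.ne').ge hE).trans ?_
  rw [selectionError, ENNReal.ofReal_add (by positivity) (by positivity)]
  gcongr

theorem trueModelMass_le_one (w : ℕ → ℝ) (lam : ℝ) (β₀ : Fin p → ℝ) :
    trueModelMass X w lam β₀ ≤ 1 := by
  calc trueModelMass X w lam β₀ ≤ ∫⁻ _, 1 ∂(dataLaw X β₀) := by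
        refine lintegral_mono fun Y => (measure_mono (Set.subset_univ _)).trans ?_
        rw [posterior, Measure.smul_apply, withDensity_apply _ MeasurableSet.univ,
          Measure.restrict_univ, smul_eq_mul]
        exact ENNReal.inv_mul_le_one _
    _ = 1 := by simp

theorem supp_zero : supp (0 : Fin p → ℝ) = ∅ := by simp [supp]

theorem compat_empty : compat X ∅ = ∞ := by simp [compat]

/-- The empty model has infinite indices, so zero always belongs to the class. This is needed
because an infimum over an empty class would be `∞` instead of at most `1`. -/
theorem zero_mem_classTilde (A₄ lam M c₀ : ℝ) {s : ℝ} (hs : 0 ≤ s) :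
    (0 : Fin p → ℝ) ∈ classTilde X A₄ lam M c₀ s := by
  refine ⟨fun i hi => ?_, ?_, ?_, ?_⟩
  · simp [supp_zero] at hi
  · simp [supp_zero, compat_empty]
  · simpa [supp_zero] using hs
  · simp [supp_zero, psiTilde, enlargedDim, compatTilde]

theorem zero_mem_classBar (A₄ lam M c₀ : ℝ) {s : ℝ} (hs : 0 ≤ s) :
    (0 : Fin p → ℝ) ∈ classBar X A₄ lam M c₀ s := by
  refine ⟨fun i hi => ?_, ?_, ?_, ?_⟩
  · simp [supp_zero] at hi
  · simp [supp_zero, compat_empty]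
  · simpa [supp_zero] using hs
  · simp [supp_zero, psiBar, enlargedDim, compatBar]

theorem tendsto_iInf_one {ι : ℕ → Type*} {C : ∀ n, Set (ι n)} {f : ∀ n, ι n → ℝ≥0∞} {δ : ℕ → ℝ}
    (hδ : Tendsto δ atTop (𝓝 0)) (hC : ∀ᶠ n in atTop, (C n).Nonempty) (hf : ∀ n x, f n x ≤ 1)
    (h : ∀ᶠ n in atTop, ∀ x ∈ C n, 1 ≤ f n x + ENNReal.ofReal (δ n)) :
    Tendsto (fun n => ⨅ x ∈ C n, f n x) atTop (𝓝 1) := by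
  have h1 : Tendsto (fun n => 1 - ENNReal.ofReal (δ n)) atTop (𝓝 1) := by
    have h2 : Tendsto (fun n => ENNReal.ofReal (δ n)) atTop (𝓝 0) := by
      simpa using ENNReal.tendsto_ofReal hδ
    simpa using ENNReal.Tendsto.sub (tendsto_const_nhds (x := (1 : ℝ≥0∞))) h2
      (Or.inl ENNReal.one_ne_top)
  refine tendsto_of_tendsto_of_tendsto_of_le_of_le' h1 tendsto_const_nhds ?_ ?_
  · filter_upwards [h] with n hn
    exact le_iInf₂ fun x hx => tsub_le_iff_right.2 (hn x hx)
  · filter_upwards [hC] with n ⟨x, hx⟩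
    exact (iInf₂_le x hx).trans (hf n x)

end SparseRegression

open SparseRegression
theorem corollary1 (A₁ A₂ A₃ A₄ : ℝ) (hA₁ : 0 < A₁) (hA₂ : 0 < A₂) (hA₃ : 0 < A₃) (hA₄ : 1 < A₄) :
    ∃ M₀ : ℝ, 0 < M₀ ∧ ∀ M : ℝ, M₀ ≤ M →
      ∀ (p : ℕ → ℕ) (X : (n : ℕ) → Matrix (Fin n) (Fin (p n)) ℝ) (lam : ℕ → ℝ)
        (w : ℕ → ℕ → ℝ) (s : ℕ → ℝ) (a c₀ : ℝ),
        Tendsto p atTop atTop →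
        (∀ᶠ n in atTop, 0 < lam n ∧ colNorm (X n) / (p n : ℝ) ≤ lam n ∧
          lam n ≤ 2 * lamBar (X n)) →
        (∀ᶠ n in atTop, IsDimPrior A₁ A₂ A₃ A₄ (p n) (w n)) →
        a < A₄ - 1 →
        (∀ᶠ n in atTop, 0 ≤ s n ∧ s n ≤ (p n : ℝ) ^ a) →
        Tendsto (fun n => s n * lam n * √(Real.log (p n)) / colNorm (X n)) atTop (𝓝 0) →
        0 < c₀ →
        Tendsto (fun n => ⨅ β₀ ∈ classTilde (X n) A₄ (lam n) M c₀ (s n),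
            trueModelMass (X n) (w n) (lam n) β₀) atTop (𝓝 1) ∧
        Tendsto (fun n => ⨅ β₀ ∈ classBar (X n) A₄ (lam n) M c₀ (s n),
            trueModelMass (X n) (w n) (lam n) β₀) atTop (𝓝 1) := by
  refine ⟨300 + A₃, by linarith, fun M hM p X lam w s a c₀ hp hlam hprior ha hs hslam hc₀ => ?_⟩
  have hc : 0 < min c₀ 1 := lt_min hc₀ one_pos
  have hpR : Tendsto (fun n => (p n : ℝ)) atTop atTop := tendsto_natCast_atTop_atTop.comp hp
  have hδ : Tendsto (fun n => selectionError A₂ (p n)) atTop (𝓝 0) :=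
    (tendsto_selectionError A₂).comp hpR
  have hdim := hpR.eventually (eventually_largeDim A₂ hA₁)
  have hsmall := hslam.eventually_le_const (u := min c₀ 1 ^ 2 / 24) (by positivity)
  have hN : ∀ᶠ n in atTop, 0 < colNorm (X n) := by
    filter_upwards [hlam] with n ⟨h0, _, h2⟩
    refine (colNorm_nonneg _).lt_of_ne fun h => ?_
    rw [lamBar, ← h] at h2
    simp at h2
    linarith
  constructor
  · refine tendsto_iInf_one hδ ?_ (fun n => trueModelMass_le_one (X n) (w n) (lam n)) ?_
    · filter_upwards [hs] with n hn using ⟨0, zero_mem_classTilde (X n) _ _ _ _ hn.1⟩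
    · filter_upwards [hlam, hprior, hs, hdim, hsmall, hN] with n ⟨h1, h2, h3⟩ h4 h5 h6 h7 h8 β₀ hβ₀
      exact one_le_trueModelMass_add_selectionError (X n) hA₁ hA₂ hA₄ h1 h2 h3 h4 ha h5.2 hc h7 h6
        hβ₀.2.2.1 (regularTruth_of_mem_classTilde (X n) h8 hA₃ hA₄ hM hc₀ hβ₀)
  · refine tendsto_iInf_one hδ ?_ (fun n => trueModelMass_le_one (X n) (w n) (lam n)) ?_
    · filter_upwards [hs] with n hn using ⟨0, zero_mem_classBar (X n) _ _ _ _ hn.1⟩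
    · filter_upwards [hlam, hprior, hs, hdim, hsmall, hN] with n ⟨h1, h2, h3⟩ h4 h5 h6 h7 h8 β₀ hβ₀
      exact one_le_trueModelMass_add_selectionError (X n) hA₁ hA₂ hA₄ h1 h2 h3 h4 ha h5.2 hc h7 h6
        hβ₀.2.2.1 (regularTruth_of_mem_classBar (X n) h8 hA₃ hA₄ hM hc₀ hβ₀)
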